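/- Let $T>0$ and write $p^-=\max(-p,0)$. For $N\ge 1$ let $S_N=\{0,\tfrac1N,\dots,1\}$ and let $V^N:[0,T]\times S_N\to\mathbb R$ be the value function of the symmetric feedback Nash equilibrium of the game with $N+1$ players on $\{-1,1\}$, with running cost $a^2/2$ for flipping at rate $a$ and final cost $-mx$ ($x$ being the state of the player and $m$ the mean state of the other players); here $V^N(t,\mu)$ is the value at time $t$ for a player in state $1$ when the fraction $\mu$ of the other players is in state $1$. That is, $V^N$ is the solution of $$-\tfrac{d}{dt}V^N(t,\mu)+\tfrac12\big([V^N(t,1-\mu)-V^N(t,\mu)]^-\big)^2 = N\mu\,[V^N(t,1-\mu)-V^N(t,\mu)]^-\,[V^N(t,\mu-\tfrac1N)-V^N(t,\mu)]$$ $$\qquad+\,N(1-\mu)\,[V^N(t,\mu+\tfrac1N)-V^N(t,1-\mu-\tfrac1N)]^-\,[V^N(t,\mu+\tfrac1N)-V^N(t,\mu)],\qquad V^N(T,\mu)=-(2\mu-1),$$ where a term with coefficient $\mu=0$ or $1-\mu=0$ is zero. Let $\mathfrak g(m,z)=\tfrac12 m z|z|-\tfrac12 z^2$ and let $Z:[0,T]\times[-1,1]\to\mathbb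 R$ be the entropy solution of $$\partial_t Z+\partial_m\,\mathfrak g(m,Z)=0,\qquad Z(0,m)=2m,$$ with possible shock on $m=0$. That is, $Z$ is $C^1$ on $[0,T]\times([-1,1]\setminus\{0\})$ and solves the equation classically there, it takes the initial datum for every $m\in[-1,1]$, and for every $t\in[0,T]$ the limits $Z_\pm(t)=\lim_{m\to0^\pm}Z(t,m)$ exist and satisfy, if they differ, the Rankine–Hugoniot condition $0=\frac{\mathfrak g(0,Z_-)-\mathfrak g(0,Z_+)}{Z_--Z_+}$ and the Lax condition $\frac{\mathfrak g(0,c)-\mathfrak g(0,Z_+)}{c-Z_+}<0<\frac{\mathfrak g(0,c)-\mathfrak g(0,Z_-)}{c-Z_-}$ for every $c$ strictly between $Z_-(t)$ and $Z_+(t)$. Let $U:[0,T]\times\{-1,1\}\times[-1,1]\to\mathbb R$ be the solution of the master equation that corresponds to $Z$. That is, with $\Delta^xU(t,x,m)=U(t,-x,m)-U(t,x,m)$ and $D^mU(t,x,m,y)=\lim_{s\downarrow0}\frac{U(t,x,m-2ys)-U(t,x,m)}{s}$, the function $U(\cdot,x,\cdot)$ is $C^1$ on $[0,T]\times([-1,1]\setminus\{0\})$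 for $x=\pm1$ and satisfies there $$-\partial_tU(t,x,m)+\tfrac12\big([\Delta^xU(t,x,m)]^-\big)^2-D^mU(t,x,m,1)\,[\Delta^xU(t,1,m)]^-\,\tfrac{1+m}2-D^mU(t,x,m,-1)\,[\Delta^xU(t,-1,m)]^-\,\tfrac{1-m}2=0$$ (the terms with coefficient $\frac{1\pm m}{2}=0$ are zero), and for all $m\in[-1,1]$, $t\in[0,T]$ one has $U(T,x,m)=-mx$ and $U(t,-1,m)-U(t,1,m)=Z(T-t,m)$. Put $U^*(t,\mu)=U(t,1,2\mu-1)$. Such $Z$, $U$ exist, and $V^N$ exists for every $N\ge1$. There are constants $C_\varepsilon$, $\varepsilon>0$, that depend only on $\varepsilon$ and $T$, with $\lim_{\varepsilon\to0}C_\varepsilon=+\infty$, such that for all $\varepsilon>0$, $N\ge1$, $t\in[0,T]$ and $\mu\in S_N\setminus(\tfrac12-\varepsilon,\tfrac12+\varepsilon)$ $$|V^N(t,\mu)-U^*(t,\mu)|\le\frac{C_\varepsilon}{N}.$$ Moreover, if $T>\tfrac12$ (so that $U^*$ is discontinuous at $\mu=\frac12$), the blow-up cannot be avoided: every family of constants $C_\varepsilon$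 for which this estimate holds satisfies $\lim_{\varepsilon\to0}C_\varepsilon=+\infty$. -/

import Mathlib

open Set Filter Topology

namespace TwoStateMFG

noncomputable section

/-- `Z` is a piecewise `C¹` entropy solution on `[0,T] × [-1,1]` of the scalar conservation law
`∂ₜ Z + ∂ₘ (g (m, Z)) = 0`, `Z (0, m) = f m`, which is `C¹` off the curve `m = γ t`: it solves the
equation classically off the curve (one-sided derivatives at the boundary of the domain), takes the
initial datum, and its one-sided limits `Zm`, `Zp` at the curve satisfy, wherever they differ,
the Rankine-Hugoniot condition and the Lax (entropy) condition. -/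
structure IsEntropySolution (g : ℝ → ℝ → ℝ) (f : ℝ → ℝ) (T : ℝ) (γ : ℝ → ℝ)
    (Z : ℝ → ℝ → ℝ) : Prop where
  curve : ContDiffOn ℝ 1 γ (Icc 0 T)
  smooth : ContDiffOn ℝ 1 (fun p : ℝ × ℝ => Z p.1 p.2)
    {p | p.1 ∈ Icc 0 T ∧ p.2 ∈ Icc (-1) 1 ∧ p.2 ≠ γ p.1}
  equation : ∀ t ∈ Icc 0 T, ∀ m ∈ Icc (-1 : ℝ) 1, m ≠ γ t →
    derivWithin (fun s => Z s m) (Icc 0 T) t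
      + derivWithin (fun y => g y (Z t y)) (Icc (-1) 1) m = 0
  initial : ∀ m ∈ Icc (-1 : ℝ) 1, Z 0 m = f m
  shock : ∀ t ∈ Icc 0 T, ∃ Zm Zp : ℝ,
    Tendsto (Z t) (𝓝[<] (γ t)) (𝓝 Zm) ∧ Tendsto (Z t) (𝓝[>] (γ t)) (𝓝 Zp) ∧
    (Zm ≠ Zp →
      derivWithin γ (Icc 0 T) t = (g (γ t) Zm - g (γ t) Zp) / (Zm - Zp)) ∧
    ∀ c ∈ Ioo (min Zm Zp) (max Zm Zp),
      (g (γ t) c - g (γ t) Zp) / (c - Zp) < derivWithin γ (Icc 0 T) t ∧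
      derivWithin γ (Icc 0 T) t < (g (γ t) c - g (γ t) Zm) / (c - Zm)

/-- The flux of the conservation law of the two-state game. -/
def flux (m z : ℝ) : ℝ := m * (z * |z|) / 2 - z ^ 2 / 2

/-- The states `1` and `-1` are the elements of `ℤˣ`; this is the state as a real number. -/
def stateVal (x : ℤˣ) : ℝ := ((x : ℤ) : ℝ)

/-- The derivative `[D^m U (t, x, m, y)]_{-y}`, that is, the right derivative at `s = 0` of `U`
when the measure is replaced by itself plus `s (δ_{-y} - δ_y)`. A measure on `{-1, 1}` is identified
with its mean `m`, which this perturbation changes into `m - 2 y s`. -/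
def measureDeriv (U : ℝ → ℤˣ → ℝ → ℝ) (t : ℝ) (x : ℤˣ) (m : ℝ) (y : ℤˣ) : ℝ :=
  derivWithin (fun s => U t x (m - 2 * stateVal y * s)) (Ici 0) 0

/-- The increment `U (t, -x, m) - U (t, x, m)`. -/
def stateDiff (U : ℝ → ℤˣ → ℝ → ℝ) (t : ℝ) (x : ℤˣ) (m : ℝ) : ℝ := U t (-x) m - U t x m

/-- `U` is the solution of the master equation on `[0,T] × {-1,1} × [-1,1]`, with Hamiltonian
`(p⁻)² / 2`, running cost `F = 0` and final cost `G (x, m) = - m x`, which corresponds to `Z`: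
it is `C¹` and solves the equation classically off `m = 0`, and its increment
`U (t, -1, m) - U (t, 1, m)` is `Z (T - t, m)`. -/
structure IsMasterSolution (T : ℝ) (Z : ℝ → ℝ → ℝ) (U : ℝ → ℤˣ → ℝ → ℝ) : Prop where
  smooth : ∀ x, ContDiffOn ℝ 1 (fun p : ℝ × ℝ => U p.1 x p.2) (Icc 0 T ×ˢ (Icc (-1) 1 \ {0}))
  equation : ∀ t ∈ Icc 0 T, ∀ m ∈ Icc (-1 : ℝ) 1, m ≠ 0 → ∀ x,
    - derivWithin (fun s => U s x m) (Icc 0 T) t + (stateDiff U t x m)⁻ ^ 2 / 2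
      - measureDeriv U t x m 1 * (stateDiff U t 1 m)⁻ * ((1 + m) / 2)
      - measureDeriv U t x m (-1) * (stateDiff U t (-1) m)⁻ * ((1 - m) / 2) = 0
  terminal : ∀ m ∈ Icc (-1 : ℝ) 1, ∀ x, U T x m = - m * stateVal x
  increment : ∀ t ∈ Icc 0 T, ∀ m ∈ Icc (-1 : ℝ) 1, stateDiff U t 1 m = Z (T - t) m

/-- The grid `S_N = {0, 1/N, ..., 1}`. -/
def grid (N : ℕ) : Set ℝ := {μ | ∃ k : ℕ, k ≤ N ∧ μ = (k : ℝ) / N}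

/-- The Hamiltonian `H p = (p⁻)² / 2`. -/
def ham (p : ℝ) : ℝ := p⁻ ^ 2 / 2

/-- `V` is the value function `V^N (t, μ)`, on `[0,T] × S_N`, of the symmetric feedback Nash
equilibrium of the game with `N + 1` players, for a player in state `1` when the fraction `μ` of the
`N` other players is in state `1`: it solves the closed Hamilton-Jacobi-Bellman system. The values
of `V` off the grid appear only with the factor zero, at `μ = 0` and at `μ = 1`. -/
structure IsNashValue (T : ℝ) (N : ℕ) (V : ℝ → ℝ → ℝ) : Prop where
  diff : ∀ μ ∈ grid N, DifferentiableOn ℝ (fun s => V s μ) (Icc 0 T)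
  equation : ∀ t ∈ Icc 0 T, ∀ μ ∈ grid N,
    - derivWithin (fun s => V s μ) (Icc 0 T) t + ham (V t (1 - μ) - V t μ) =
      N * μ * (V t (1 - μ) - V t μ)⁻ * (V t (μ - 1 / N) - V t μ)
      + N * (1 - μ) * (V t (μ + 1 / N) - V t (1 - μ - 1 / N))⁻ * (V t (μ + 1 / N) - V t μ)
  terminal : ∀ μ ∈ grid N, V T μ = - (2 * μ - 1)

/-- The estimate `|V^N (t, μ) - U* (t, μ)| ≤ C ε / N`, where `U* (t, μ) = U (t, 1, 2 μ - 1)`, for all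
`ε > 0`, `N ≥ 1`, `t ∈ [0,T]` and all grid points `μ` at distance at least `ε` from `1/2`. -/
def ValueEstimate (T : ℝ) (U : ℝ → ℤˣ → ℝ → ℝ) (V : ℕ → ℝ → ℝ → ℝ) (C : ℝ → ℝ) : Prop :=
  ∀ ε > 0, ∀ N : ℕ, 1 ≤ N → ∀ t ∈ Icc 0 T,
    ∀ μ ∈ grid N \ Ioo (1 / 2 - ε) (1 / 2 + ε),
      |V N t μ - U t 1 (2 * μ - 1)| ≤ C ε / N

end

end TwoStateMFG

/-! The characteristic of the conservation law that starts at `x > 0` is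
`m = 1 - (1 - x) * (1 + x * t) ^ 2`, with `Z = 2 * x / (1 + x * t)` along it. Those that have not
met the shock are spread apart, so that their feet are functions of `(t, m)`, with a Lipschitz
constant of order `1 / m`. This gives `Z` and `U` explicitly on each side of `m = 0`, and following
a classical solution backwards along the characteristics shows that there is no other one.

For the `N + 1` players, the maximum principle shows that, except at a near tie, no player in the
majority flips. The system thus decouples, on each side of `μ = 1 / 2`, into a reduced one with
transport towards the end of the grid. Away from `μ = 1 / 2` the limit solves the reduced system up
to a defect of order `1 / N`, and a second application of the maximum principle turns the defect
into the error estimate.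

Suppose that the constants did not blow up. Then the estimate would hold with one constant at every
grid point but `1 / 2` itself. For odd `N`, the equation at the points next to `1 / 2` contains a
term of order `N` times the square of the jump of the limit, which is bounded away from zero
beyond any time after the formation of the shock; this term would make the bounded value function
unbounded. -/

namespace TwoStateMFG

noncomputable section

/-! ### Characteristics of the conservation law -/

/-- The position at time `t` of the characteristic of the conservation law that starts at `x ≥ 0`.
Along it, `Z = 2 * x / (1 + x * t)` and `1 - m = (1 - x) * (1 + x * t) ^ 2`. -/
def charPos (t x : ℝ) : ℝ := 1 - (1 - x) * (1 + x * t) ^ 2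

/-- The derivative of `charPos t` at `x`. -/
def charSlope (t x : ℝ) : ℝ := (1 + x * t) * (1 - 2 * t + 3 * t * x)

lemma hasDerivAt_charPos (t x : ℝ) : HasDerivAt (charPos t) (charSlope t x) x := by
  have hfactor : HasDerivAt (fun x : ℝ => 1 + x * t) t x := by
    simpa using ((hasDerivAt_id x).mul_const t).const_add 1
  refine ((((hasDerivAt_id x).const_sub 1).mul (hfactor.pow 2)).const_sub 1).congr_deriv ?_
  simp [charSlope]
  ring

lemma hasDerivAt_charPos_time (t x : ℝ) :
    HasDerivAt (fun s => charPos s x) (-(2 * x * (1 - x) * (1 + x * t))) t := by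
  have hfactor : HasDerivAt (fun s : ℝ => 1 + x * s) x t := by
    simpa using ((hasDerivAt_id t).const_mul x).const_add 1
  refine (((hfactor.pow 2).const_mul (1 - x)).const_sub 1).congr_deriv ?_
  simp
  ring

lemma continuous_charPos (t : ℝ) : Continuous (charPos t) := by
  unfold charPos
  fun_prop

lemma charPos_zero_right (t : ℝ) : charPos t 0 = 0 := by simp [charPos]

lemma charPos_one_right (t : ℝ) : charPos t 1 = 1 := by simp [charPos]

lemma charPos_zero_left (x : ℝ) : charPos 0 x = x := by simp [charPos]

lemma charPos_le_one {t x : ℝ} (hx : x ≤ 1) : charPos t x ≤ 1 :=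
  sub_le_self 1 (mul_nonneg (sub_nonneg.2 hx) (sq_nonneg _))

lemma charPos_anti {s t x : ℝ} (hs : 0 ≤ s) (hst : s ≤ t) (hx0 : 0 ≤ x) (hx : x ≤ 1) :
    charPos t x ≤ charPos s x := by
  have : 0 ≤ 1 - x := sub_nonneg.2 hx
  unfold charPos
  gcongr

lemma charPos_mem_of_le {s t x : ℝ} (hs : 0 ≤ s) (hst : s ≤ t) (hx : x ∈ Icc (0 : ℝ) 1)
    (h : 0 < charPos t x) : charPos s x ∈ Ioc (0 : ℝ) 1 :=
  ⟨h.trans_le (charPos_anti hs hst hx.1 hx.2), charPos_le_one hx.2⟩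

/-- As long as a characteristic has not met the shock, those that start further right are spread
out: this is what makes the foot of a characteristic a well-defined Lipschitz function. -/
lemma charPos_add_mul_le_charSlope {t x y : ℝ} (ht : 0 ≤ t) (hx0 : 0 < x) (hx : x ≤ 1)
    (hxy : x ≤ y) (h : 0 < charPos t x) : charPos t x + t * x ≤ charSlope t y := by
  set q := 1 - 2 * t + x * (2 * t - t ^ 2) + x ^ 2 * t ^ 2
  have hfactor : charPos t x = x * q := by
    unfold charPos; ring
  have hq0 : 0 < q := pos_of_mul_pos_right (hfactor ▸ h) hx0.le
  have hpos_le : charPos t x ≤ q := hfactor ▸ mul_le_of_le_one_left hq0.le hx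
  have hq_le : q + t * x ≤ 1 - 2 * t + 3 * t * x := by
    have : 0 ≤ t ^ 2 * (x * (1 - x)) :=
      mul_nonneg (sq_nonneg t) (mul_nonneg hx0.le (sub_nonneg.2 hx))
    linarith
  have hmono : 1 - 2 * t + 3 * t * x ≤ 1 - 2 * t + 3 * t * y := by gcongr
  have htx : 0 ≤ t * x := by positivity
  have hyt : 1 ≤ 1 + y * t := le_add_of_nonneg_right (mul_nonneg (hx0.le.trans hxy) ht)
  exact (by linarith : _ ≤ 1 - 2 * t + 3 * t * y).trans
    (le_mul_of_one_le_left (by linarith) hyt)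

lemma mul_sub_le_charPos_sub {t x y : ℝ} (ht : 0 ≤ t) (hx0 : 0 < x) (hx : x ≤ 1) (hxy : x ≤ y)
    (h : 0 < charPos t x) :
    (charPos t x + t * x) * (y - x) ≤ charPos t y - charPos t x := by
  have hd : Differentiable ℝ (charPos t) := fun w => (hasDerivAt_charPos t w).differentiableAt
  refine Convex.mul_sub_le_image_sub_of_le_deriv (convex_Icc x y) hd.continuous.continuousOn
    hd.differentiableOn (fun w hw => ?_) x (left_mem_Icc.2 hxy) y (right_mem_Icc.2 hxy) hxy
  rw [(hasDerivAt_charPos t w).deriv]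
  exact charPos_add_mul_le_charSlope ht hx0 hx (interior_subset hw).1 h

lemma charPos_lt {t x y : ℝ} (ht : 0 ≤ t) (hx0 : 0 < x) (hx : x ≤ 1) (hxy : x < y)
    (h : 0 < charPos t x) : charPos t x < charPos t y := by
  have hpos : 0 < (charPos t x + t * x) * (y - x) :=
    mul_pos (by positivity) (sub_pos.2 hxy)
  linarith [mul_sub_le_charPos_sub ht hx0 hx hxy.le h]

lemma abs_charPos_sub_sub_le {t x y : ℝ} (ht : 0 ≤ t) (hx : x ∈ Icc (0 : ℝ) 1)
    (hy : y ∈ Icc (0 : ℝ) 1) :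
    |charPos t y - charPos t x - charSlope t x * (y - x)| ≤ (2 * t + 2 * t ^ 2) * (y - x) ^ 2 := by
  have hrem : charPos t y - charPos t x - charSlope t x * (y - x)
      = (2 * t + t ^ 2 * (2 * x + y - 1)) * (y - x) ^ 2 := by
    unfold charPos charSlope; ring
  rw [hrem, abs_mul, abs_of_nonneg (sq_nonneg (y - x))]
  refine mul_le_mul_of_nonneg_right (abs_le.2 ⟨?_, ?_⟩) (sq_nonneg _) <;>
    nlinarith [sq_nonneg t, hx.1, hx.2, hy.1, hy.2]

/-- The starting point of the characteristic that is at `m > 0` at time `t`. -/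
def charFoot (t m : ℝ) : ℝ := Function.invFunOn (charPos t) (Ioc 0 1) m

section CharFoot

variable {t m : ℝ}

lemma exists_charPos_eq (hm : m ∈ Ioc (0 : ℝ) 1) : ∃ x ∈ Ioc (0 : ℝ) 1, charPos t x = m := by
  have hivt := intermediate_value_Ioc zero_le_one (continuous_charPos t).continuousOn
  rw [charPos_zero_right, charPos_one_right] at hivt
  exact hivt hm

lemma charFoot_mem (hm : m ∈ Ioc (0 : ℝ) 1) : charFoot t m ∈ Ioc (0 : ℝ) 1 :=
  Function.invFunOn_mem (exists_charPos_eq hm)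

lemma charPos_charFoot (hm : m ∈ Ioc (0 : ℝ) 1) : charPos t (charFoot t m) = m :=
  Function.invFunOn_eq (exists_charPos_eq hm)

lemma charPos_charFoot_pos (hm : m ∈ Ioc (0 : ℝ) 1) : 0 < charPos t (charFoot t m) :=
  (charPos_charFoot hm).symm ▸ hm.1

lemma charFoot_mono {n : ℝ} (ht : 0 ≤ t) (hm : m ∈ Ioc (0 : ℝ) 1) (hn : n ∈ Ioc (0 : ℝ) 1)
    (hmn : m ≤ n) : charFoot t m ≤ charFoot t n := by
  by_contra! hlt
  have hfoot := charFoot_mem (t := t) hn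
  have := charPos_lt ht hfoot.1 hfoot.2 hlt (charPos_charFoot_pos hn)
  rw [charPos_charFoot hm, charPos_charFoot hn] at this
  exact this.not_ge hmn

lemma charFoot_charPos {x : ℝ} (ht : 0 ≤ t) (hx : x ∈ Ioc (0 : ℝ) 1) (h : 0 < charPos t x) :
    charFoot t (charPos t x) = x := by
  have hm : charPos t x ∈ Ioc (0 : ℝ) 1 := ⟨h, charPos_le_one hx.2⟩
  have hfoot := charFoot_mem (t := t) hm
  rcases lt_trichotomy (charFoot t (charPos t x)) x with hlt | heq | hlt
  · exact absurd (charPos_charFoot hm)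
      (charPos_lt ht hfoot.1 hfoot.2 hlt (charPos_charFoot_pos hm)).ne
  · exact heq
  · exact absurd (charPos_charFoot hm) (charPos_lt ht hx.1 hx.2 hlt h).ne'

lemma charFoot_zero_left (hm : m ∈ Ioc (0 : ℝ) 1) : charFoot 0 m = m := by
  simpa only [charPos_zero_left] using
    charFoot_charPos le_rfl hm (by rw [charPos_zero_left]; exact hm.1)

lemma mul_charFoot_sub_le {n : ℝ} (ht : 0 ≤ t) (hm : m ∈ Ioc (0 : ℝ) 1)
    (hn : n ∈ Ioc (0 : ℝ) 1) (hmn : m ≤ n) :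
    (m + t * charFoot t m) * (charFoot t n - charFoot t m) ≤ n - m := by
  have hfoot := charFoot_mem (t := t) hm
  simpa only [charPos_charFoot hm, charPos_charFoot hn] using
    mul_sub_le_charPos_sub ht hfoot.1 hfoot.2 (charFoot_mono ht hm hn hmn)
      (charPos_charFoot_pos hm)

lemma le_charSlope_charFoot (ht : 0 ≤ t) (hm : m ∈ Ioc (0 : ℝ) 1) :
    m ≤ charSlope t (charFoot t m) := by
  have hfoot := charFoot_mem (t := t) hm
  have := charPos_add_mul_le_charSlope ht hfoot.1 hfoot.2 le_rfl (charPos_charFoot_pos hm)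
  rw [charPos_charFoot hm] at this
  linarith [mul_nonneg ht hfoot.1.le]

lemma charSlope_charFoot_pos (ht : 0 ≤ t) (hm : m ∈ Ioc (0 : ℝ) 1) :
    0 < charSlope t (charFoot t m) := hm.1.trans_le (le_charSlope_charFoot ht hm)

end CharFoot

/-- The value of the entropy solution at time `t` on the characteristic that starts at `x ≥ 0`. -/
def charVal (t x : ℝ) : ℝ := 2 * x / (1 + x * t)

/-- The value `U (T - t, -1, ·)` on the characteristic that starts at `x ≥ 0`. -/
def charCost (t x : ℝ) : ℝ := -x + charVal t x

section CharVal

variable {t x y : ℝ}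

lemma charVal_nonneg (ht : 0 ≤ t) (hx : 0 ≤ x) : 0 ≤ charVal t x := by
  unfold charVal; positivity

lemma charVal_le (ht : 0 ≤ t) (hx : 0 ≤ x) : charVal t x ≤ 2 * x :=
  div_le_self (by positivity) (le_add_of_nonneg_right (mul_nonneg hx ht))

lemma charVal_sub (ht : 0 ≤ t) (hx : 0 ≤ x) (hy : 0 ≤ y) :
    charVal t y - charVal t x = 2 * (y - x) / ((1 + y * t) * (1 + x * t)) := by
  have : 0 < 1 + x * t := by positivity
  have : 0 < 1 + y * t := by positivity
  unfold charVal
  field_simp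
  ring

lemma charVal_sub_mem (ht : 0 ≤ t) (hx : 0 ≤ x) (hxy : x ≤ y) :
    charVal t y - charVal t x ∈ Icc 0 (2 * (y - x)) := by
  have hy := hx.trans hxy
  have : 0 ≤ y - x := sub_nonneg.2 hxy
  rw [charVal_sub ht hx hy]
  exact ⟨by positivity, div_le_self (by positivity) (one_le_mul_of_one_le_of_one_le
    (le_add_of_nonneg_right (mul_nonneg hy ht)) (le_add_of_nonneg_right (mul_nonneg hx ht)))⟩

lemma abs_charCost_sub_le (ht : 0 ≤ t) (hx : 0 ≤ x) (hxy : x ≤ y) :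
    |charCost t y - charCost t x| ≤ y - x := by
  obtain ⟨hnonneg, hle⟩ := charVal_sub_mem ht hx hxy
  unfold charCost
  exact abs_le.2 ⟨by linarith, by linarith⟩

lemma abs_charCost_sub_sub_le (ht : 0 ≤ t) (hx : 0 ≤ x) (hy : 0 ≤ y) :
    |charCost t y - charCost t x - (-1 + 2 / (1 + x * t) ^ 2) * (y - x)| ≤ 2 * t * (y - x) ^ 2 := by
  have hxt : 1 ≤ 1 + x * t := le_add_of_nonneg_right (mul_nonneg hx ht)
  have hyt : 1 ≤ 1 + y * t := le_add_of_nonneg_right (mul_nonneg hy ht)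
  have hrem : charCost t y - charCost t x - (-1 + 2 / (1 + x * t) ^ 2) * (y - x)
      = -(2 * t * (y - x) ^ 2 / ((1 + y * t) * (1 + x * t) ^ 2)) := by
    have hsplit : charCost t y - charCost t x = -(y - x) + (charVal t y - charVal t x) := by
      unfold charCost; ring
    rw [hsplit, charVal_sub ht hx hy]
    field_simp
    ring
  rw [hrem, abs_neg, abs_of_nonneg (by positivity)]
  exact div_le_self (by positivity) (one_le_mul_of_one_le_of_one_le hyt (one_le_pow₀ hxt))

lemma abs_charCost_le (ht : 0 ≤ t) (hx : x ∈ Icc (0 : ℝ) 1) : |charCost t x| ≤ 1 := by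
  have hle := charVal_le ht hx.1
  have hnonneg := charVal_nonneg ht hx.1
  unfold charCost
  exact abs_le.2 ⟨by linarith [hx.2], by linarith [hx.2]⟩

end CharVal

/-! ### A maximum principle for finite systems -/

lemma deriv_nonneg_of_isMaxOn_Icc {f : ℝ → ℝ} {f' a b t : ℝ} (ht : t ∈ Ioc a b)
    (hf : HasDerivWithinAt f f' (Icc a b) t) (hmax : IsMaxOn f (Icc a b) t) : 0 ≤ f' := by
  have hcone : a - t ∈ posTangentConeAt (Icc a b) t := by
    refine sub_mem_posTangentConeAt_of_segment_subset ?_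
    rw [segment_symm, segment_eq_Icc ht.1.le]
    exact Icc_subset_Icc le_rfl ht.2
  have hslope := hmax.localize.hasFDerivWithinAt_nonpos hf.hasFDerivWithinAt hcone
  simp only [ContinuousLinearMap.toSpanSingleton_apply, smul_eq_mul] at hslope
  exact nonneg_of_mul_nonpos_right hslope (sub_neg.2 ht.1)

section MaximumPrinciple

variable {ι : Type*} {S : Finset ι} {w w' : ι → ℝ → ℝ} {T L a : ℝ}

lemma nonpos_of_deriv_neg_of_isMax
    (hw : ∀ i ∈ S, ∀ t ∈ Icc 0 T, HasDerivWithinAt (w i) (w' i t) (Icc 0 T) t)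
    (h0 : ∀ i ∈ S, w i 0 ≤ 0)
    (h : ∀ i ∈ S, ∀ t ∈ Icc 0 T, (∀ j ∈ S, w j t ≤ w i t) → 0 < w i t → w' i t < 0) :
    ∀ i ∈ S, ∀ t ∈ Icc 0 T, w i t ≤ 0 := by
  intro i₀ hi₀ t₀ ht₀
  by_contra! hpos
  have hmax : ∀ i ∈ S, ∃ t ∈ Icc 0 T, IsMaxOn (w i) (Icc 0 T) t := fun i hi =>
    isCompact_Icc.exists_isMaxOn ⟨t₀, ht₀⟩ fun t ht => (hw i hi t ht).continuousWithinAt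
  choose! τ hτ hτmax using hmax
  obtain ⟨i, hi, himax⟩ := S.exists_max_image (fun i => w i (τ i)) ⟨i₀, hi₀⟩
  have hglobal : ∀ j ∈ S, ∀ t ∈ Icc 0 T, w j t ≤ w i (τ i) := fun j hj t ht =>
    (hτmax j hj ht).trans (himax j hj)
  have hwpos : 0 < w i (τ i) := hpos.trans_le (hglobal i₀ hi₀ t₀ ht₀)
  have hτpos : 0 < τ i := (hτ i hi).1.lt_of_ne fun h => (h0 i hi).not_gt (h ▸ hwpos)
  exact (h i hi _ (hτ i hi) (fun j hj => hglobal j hj _ (hτ i hi)) hwpos).not_ge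
    (deriv_nonneg_of_isMaxOn_Icc ⟨hτpos, (hτ i hi).2⟩ (hw i hi _ (hτ i hi)) (hτmax i hi))

lemma nonpos_of_deriv_le_mul_of_isMax
    (hw : ∀ i ∈ S, ∀ t ∈ Icc 0 T, HasDerivWithinAt (w i) (w' i t) (Icc 0 T) t)
    (h0 : ∀ i ∈ S, w i 0 ≤ 0)
    (h : ∀ i ∈ S, ∀ t ∈ Icc 0 T, (∀ j ∈ S, w j t ≤ w i t) → 0 < w i t → w' i t ≤ L * w i t) :
    ∀ i ∈ S, ∀ t ∈ Icc 0 T, w i t ≤ 0 := by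
  have hexp (t : ℝ) : HasDerivAt (fun t : ℝ => Real.exp (-(L + 1) * t))
      (Real.exp (-(L + 1) * t) * (-(L + 1))) t := by
    simpa using ((hasDerivAt_id t).const_mul (-(L + 1))).exp
  have hweighted := nonpos_of_deriv_neg_of_isMax (S := S) (T := T)
    (w := fun i t => Real.exp (-(L + 1) * t) * w i t)
    (fun i hi t ht => (hexp t).hasDerivWithinAt.mul (hw i hi t ht))
    (fun i hi => mul_nonpos_of_nonneg_of_nonpos (Real.exp_pos _).le (h0 i hi)) ?_
  · exact fun i hi t ht => nonpos_of_mul_nonpos_right (hweighted i hi t ht) (Real.exp_pos _)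
  · intro i hi t ht hmax hpos
    have hE := Real.exp_pos (-(L + 1) * t)
    have hwpos : 0 < w i t := pos_of_mul_pos_right hpos hE.le
    have hle := h i hi t ht (fun j hj => le_of_mul_le_mul_left (hmax j hj) hE) hwpos
    calc Real.exp (-(L + 1) * t) * (-(L + 1)) * w i t + Real.exp (-(L + 1) * t) * w' i t
        = Real.exp (-(L + 1) * t) * (w' i t - (L + 1) * w i t) := by ring
      _ < 0 := mul_neg_of_pos_of_neg hE (by linarith)

lemma le_of_deriv_nonpos_of_isMax
    (hw : ∀ i ∈ S, ∀ t ∈ Icc 0 T, HasDerivWithinAt (w i) (w' i t) (Icc 0 T) t)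
    (h0 : ∀ i ∈ S, w i 0 ≤ a)
    (h : ∀ i ∈ S, ∀ t ∈ Icc 0 T, (∀ j ∈ S, w j t ≤ w i t) → w' i t ≤ 0) :
    ∀ i ∈ S, ∀ t ∈ Icc 0 T, w i t ≤ a := by
  have hshift := nonpos_of_deriv_le_mul_of_isMax (S := S) (T := T) (L := 0)
    (w := fun i t => w i t - a) (fun i hi t ht => (hw i hi t ht).sub_const a)
    (fun i hi => sub_nonpos.2 (h0 i hi)) (fun i hi t ht hmax _ => by
      rw [zero_mul]
      exact h i hi t ht fun j hj => (sub_le_sub_iff_right a).1 (hmax j hj))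
  exact fun i hi t ht => sub_nonpos.1 (hshift i hi t ht)

lemma le_mul_exp_of_deriv_le_of_isMax (hL : 0 ≤ L) (ha : 0 ≤ a)
    (hw : ∀ i ∈ S, ∀ t ∈ Icc 0 T, HasDerivWithinAt (w i) (w' i t) (Icc 0 T) t)
    (h0 : ∀ i ∈ S, w i 0 ≤ 0)
    (h : ∀ i ∈ S, ∀ t ∈ Icc 0 T, (∀ j ∈ S, w j t ≤ w i t) → 0 < w i t →
      w' i t ≤ L * w i t + a) :
    ∀ i ∈ S, ∀ t ∈ Icc 0 T, w i t ≤ a * Real.exp ((L + 1) * T) := by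
  have hexp (t : ℝ) : HasDerivAt (fun t : ℝ => a * Real.exp ((L + 1) * t))
      (a * (Real.exp ((L + 1) * t) * (L + 1))) t := by
    simpa using (((hasDerivAt_id t).const_mul (L + 1)).exp).const_mul a
  have hbarrier := nonpos_of_deriv_le_mul_of_isMax (S := S) (T := T) (L := L)
    (w := fun i t => w i t - a * Real.exp ((L + 1) * t))
    (fun i hi t ht => (hw i hi t ht).sub (hexp t).hasDerivWithinAt)
    (fun i hi => by
      simp only [mul_zero, Real.exp_zero, mul_one]
      linarith [h0 i hi]) ?_
  · intro i hi t ht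
    calc w i t ≤ a * Real.exp ((L + 1) * t) := sub_nonpos.1 (hbarrier i hi t ht)
      _ ≤ a * Real.exp ((L + 1) * T) := by
        gcongr
        exact ht.2
  · intro i hi t ht hmax hpos
    have hE : a * 1 ≤ a * Real.exp ((L + 1) * t) := by
      gcongr
      exact Real.one_le_exp (mul_nonneg (by linarith) ht.1)
    have hle := h i hi t ht (fun j hj => by simpa using hmax j hj) (by linarith)
    linarith

lemma abs_le_mul_exp_of_deriv_le_of_isMax (hL : 0 ≤ L) (ha : 0 ≤ a)
    (hw : ∀ i ∈ S, ∀ t ∈ Icc 0 T, HasDerivWithinAt (w i) (w' i t) (Icc 0 T) t)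
    (h0 : ∀ i ∈ S, w i 0 = 0)
    (h : ∀ i ∈ S, ∀ t ∈ Icc 0 T, ∀ σ : ℝ, |σ| = 1 → (∀ j ∈ S, |w j t| ≤ σ * w i t) →
      σ * w' i t ≤ L * (σ * w i t) + a) :
    ∀ i ∈ S, ∀ t ∈ Icc 0 T, |w i t| ≤ a * Real.exp ((L + 1) * T) := by
  have hsigned := le_mul_exp_of_deriv_le_of_isMax (S := S ×ˢ ({1, -1} : Finset ℝ)) (T := T)
    (w := fun p t => p.2 * w p.1 t) hL ha
    (fun p hp t ht => (hw p.1 (Finset.mem_product.1 hp).1 t ht).const_mul p.2)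
    (fun p hp => by simp [h0 p.1 (Finset.mem_product.1 hp).1]) ?_
  · intro i hi t ht
    have hplus := hsigned (i, 1) (by simp [hi]) t ht
    have hminus := hsigned (i, -1) (by simp [hi]) t ht
    exact abs_le'.2 ⟨by linarith, by linarith⟩
  · rintro ⟨i, σ⟩ hp t ht hmax -
    simp only [Finset.mem_product, Finset.mem_insert, Finset.mem_singleton] at hp
    refine h i hp.1 t ht σ (by rcases hp.2 with rfl | rfl <;> simp) fun j hj => ?_
    have hplus := hmax (j, 1) (by simp [hj])
    have hminus := hmax (j, -1) (by simp [hj])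
    exact abs_le'.2 ⟨by linarith, by linarith⟩

end MaximumPrinciple

/-! ### The game with `N + 1` players -/

lemma negPart_sub_of_le {a b : ℝ} (h : a ≤ b) : (a - b)⁻ = b - a := by
  rw [negPart_of_nonpos (sub_nonpos.2 h), neg_sub]

lemma negPart_sub_of_ge {a b : ℝ} (h : b ≤ a) : (a - b)⁻ = 0 :=
  negPart_eq_zero.2 (sub_nonneg.2 h)

lemma negPart_sub_le {a b η : ℝ} (hη : 0 ≤ η) (h : b - a ≤ η) : (a - b)⁻ ≤ η := by
  rw [negPart_def, neg_sub]
  exact sup_le h hη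

lemma abs_sub_le_two {a b : ℝ} (ha : |a| ≤ 1) (hb : |b| ≤ 1) : |a - b| ≤ 2 :=
  (abs_sub a b).trans (by linarith)

lemma natCast_sub_le (N k : ℕ) : ((N - k : ℕ) : ℝ) ≤ N := by
  exact_mod_cast Nat.sub_le N k

/-- The right-hand side of the closed system at the grid point `k / N`, in reversed time. The
subtractions are truncated, which only matters in terms with the factor zero. -/
def gridField (N : ℕ) (x : ℕ → ℝ) (k : ℕ) : ℝ :=
  -ham (x (N - k) - x k) + k * (x (N - k) - x k)⁻ * (x (k - 1) - x k)
    + ((N - k : ℕ) : ℝ) * (x (k + 1) - x (N - (k + 1)))⁻ * (x (k + 1) - x k)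

/-- `v k s` is the value `V (T - s) (k / N)` of the game with `N + 1` players. -/
structure IsGridValue (T : ℝ) (N : ℕ) (v : ℕ → ℝ → ℝ) : Prop where
  initial : ∀ k ≤ N, v k 0 = 1 - 2 * k / N
  deriv : ∀ k ≤ N, ∀ s ∈ Icc 0 T,
    HasDerivWithinAt (v k) (gridField N (fun j => v j s) k) (Icc 0 T) s

/-- The contribution to `gridField` of the other players that are in state `-1`. -/
def upField (N : ℕ) (x : ℕ → ℝ) (k : ℕ) : ℝ :=
  ((N - k : ℕ) : ℝ) * (x (k + 1) - x (N - (k + 1)))⁻ * (x (k + 1) - x k)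

section GridField

variable {N k : ℕ} {x : ℕ → ℝ} {η : ℝ}

lemma abs_one_sub_two_mul_div_le (hk : k ≤ N) : |1 - 2 * (k : ℝ) / N| ≤ 1 := by
  have hnonneg : 0 ≤ (k : ℝ) / N := by positivity
  have hle : (k : ℝ) / N ≤ 1 := div_le_one_of_le₀ (by exact_mod_cast hk) (by positivity)
  rw [mul_div_assoc]
  exact abs_le.2 ⟨by linarith, by linarith⟩

lemma upField_nonpos (hk : k ≤ N) (h : ∀ j ≤ N, x j ≤ x k) : upField N x k ≤ 0 := by
  rcases hk.eq_or_lt with rfl | hk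
  · simp [upField]
  · exact mul_nonpos_of_nonneg_of_nonpos (mul_nonneg (Nat.cast_nonneg _) (negPart_nonneg _))
      (sub_nonpos.2 (h (k + 1) hk))

lemma upField_nonneg (h : k < N → x k ≤ x (k + 1)) : 0 ≤ upField N x k := by
  rcases lt_or_ge k N with hk | hk
  · exact mul_nonneg (mul_nonneg (Nat.cast_nonneg _) (negPart_nonneg _)) (sub_nonneg.2 (h hk))
  · simp [upField, Nat.sub_eq_zero_of_le hk]

lemma gridField_nonpos (hk : k ≤ N) (h : ∀ j ≤ N, x j ≤ x k) : gridField N x k ≤ 0 := by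
  have hham : 0 ≤ ham (x (N - k) - x k) := by unfold ham; positivity
  have hdown : k * (x (N - k) - x k)⁻ * (x (k - 1) - x k) ≤ 0 :=
    mul_nonpos_of_nonneg_of_nonpos (mul_nonneg (Nat.cast_nonneg _) (negPart_nonneg _))
      (sub_nonpos.2 (h (k - 1) (by omega)))
  have hup := upField_nonpos hk h
  unfold gridField
  unfold upField at hup
  linarith

lemma gridField_nonneg (h : ∀ j ≤ N, x k ≤ x j) : 0 ≤ gridField N x k := by
  have hup := upField_nonneg (N := N) (x := x) (k := k) fun hk => h (k + 1) hk
  unfold gridField ham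
  unfold upField at hup
  rw [negPart_sub_of_ge (h (N - k) (N.sub_le k))]
  linarith

lemma abs_gridField_sub_upField_le (hη : 0 ≤ η) (hb : ∀ j ≤ N, |x j| ≤ 1) (hk : k ≤ N)
    (hstate : x k - x (N - k) ≤ η) :
    |gridField N x k - upField N x k| ≤ (2 * N + 1) * η := by
  set p := (x (N - k) - x k)⁻
  have hdiff : gridField N x k - upField N x k = -(p ^ 2 / 2) + k * p * (x (k - 1) - x k) := by
    unfold gridField upField ham; ring
  have hp0 : 0 ≤ p := negPart_nonneg _
  have hpη : p ≤ η := negPart_sub_le hη hstate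
  have hp2 : p ≤ 2 := negPart_sub_le zero_le_two
    ((le_abs_self _).trans (abs_sub_le_two (hb k hk) (hb (N - k) (by omega))))
  have hdown : |k * p * (x (k - 1) - x k)| ≤ N * η * 2 := by
    rw [abs_mul, abs_of_nonneg (by positivity : 0 ≤ k * p)]
    have := abs_sub_le_two (hb (k - 1) (by omega)) (hb k hk)
    gcongr
  have hsq : |-(p ^ 2 / 2)| ≤ η := by
    rw [abs_neg, abs_of_nonneg (by positivity)]
    nlinarith
  calc |gridField N x k - upField N x k|
      ≤ |-(p ^ 2 / 2)| + |k * p * (x (k - 1) - x k)| := hdiff ▸ abs_add_le _ _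
    _ ≤ (2 * N + 1) * η := by linarith

lemma upField_le (hη : 0 ≤ η) (hb : ∀ j ≤ N, |x j| ≤ 1)
    (hsucc : k < N → x (k + 1) - x k ≤ η) : upField N x k ≤ 2 * N * η := by
  rcases lt_or_ge k N with hk | hk
  · have hrate : (x (k + 1) - x (N - (k + 1)))⁻ ≤ 2 := negPart_sub_le zero_le_two
      ((le_abs_self _).trans (abs_sub_le_two (hb _ (by omega)) (hb _ hk)))
    have hcoeff : 0 ≤ ((N - k : ℕ) : ℝ) * (x (k + 1) - x (N - (k + 1)))⁻ :=
      mul_nonneg (Nat.cast_nonneg _) (negPart_nonneg _)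
    calc upField N x k
        ≤ ((N - k : ℕ) : ℝ) * (x (k + 1) - x (N - (k + 1)))⁻ * η :=
          mul_le_mul_of_nonneg_left (hsucc hk) hcoeff
      _ ≤ N * 2 * η := by
          have := natCast_sub_le N k
          gcongr
      _ = 2 * N * η := by ring
  · simp only [upField, Nat.sub_eq_zero_of_le hk, Nat.cast_zero, zero_mul]
    positivity

lemma neg_le_gridField_reflect (hη : 0 ≤ η) (hb : ∀ j ≤ N, |x j| ≤ 1)
    (hstate : ∀ j ≤ N, N ≤ 2 * j → x j - x (N - j) ≤ η) (hk : k ≤ N) (hkN : N < 2 * k)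
    (hle : x (N - k) ≤ x k) : -(2 * N * η) ≤ gridField N x (N - k) := by
  have hfield : gridField N x (N - k) = (k : ℝ) * (x (N - (k - 1)) - x (k - 1))⁻
      * (x (N - (k - 1)) - x (N - k)) := by
    unfold gridField ham
    rw [show N - (N - k) = k by omega, show N - k + 1 = N - (k - 1) by omega,
      show N - (N - (k - 1)) = k - 1 by omega, negPart_sub_of_ge hle]
    ring
  have hrate : (x (N - (k - 1)) - x (k - 1))⁻ ≤ η := by
    refine negPart_sub_le hη ?_
    rcases le_or_gt N (2 * (k - 1)) with hge | hlt
    · exact hstate (k - 1) (by omega) hge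
    · rw [show N - (k - 1) = k by omega, show k - 1 = N - k by omega]
      linarith
  have habs : |gridField N x (N - k)| ≤ N * η * 2 := by
    have := negPart_nonneg (x (N - (k - 1)) - x (k - 1))
    have := abs_sub_le_two (hb (N - (k - 1)) (by omega)) (hb (N - k) (by omega))
    rw [hfield, abs_mul, abs_of_nonneg (by positivity)]
    gcongr
  linarith [neg_le_of_abs_le habs]

lemma gridField_sub_reflect_le (hη : 0 ≤ η) (hb : ∀ j ≤ N, |x j| ≤ 1)
    (hstate : ∀ j ≤ N, N ≤ 2 * j → x j - x (N - j) ≤ η)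
    (hsucc : k < N → x (k + 1) - x k ≤ η) (hk : k ≤ N) (hkN : N < 2 * k)
    (hle : x (N - k) ≤ x k) :
    gridField N x k - gridField N x (N - k) ≤ (6 * N + 2) * η := by
  have happrox := le_of_abs_le (abs_gridField_sub_upField_le hη hb hk (hstate k hk hkN.le))
  linarith [upField_le hη hb hsucc, neg_le_gridField_reflect hη hb hstate hk hkN hle]

lemma gridField_succ_sub_le (hη : 0 ≤ η) (hb : ∀ j ≤ N, |x j| ≤ 1)
    (hstate : ∀ j ≤ N, N ≤ 2 * j → x j - x (N - j) ≤ η)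
    (hsucc : k + 1 < N → x (k + 2) - x (k + 1) ≤ η) (hk : k < N) (hkN : N ≤ 2 * k)
    (hle : x k ≤ x (k + 1)) :
    gridField N x (k + 1) - gridField N x k ≤ (6 * N + 2) * η := by
  have happrox := abs_le.1 (abs_gridField_sub_upField_le hη hb hk.le (hstate k hk.le hkN))
  have happrox_succ :=
    abs_le.1 (abs_gridField_sub_upField_le hη hb hk (hstate (k + 1) hk (by omega)))
  linarith [upField_le hη hb hsucc, upField_nonneg (N := N) fun _ => hle]

end GridField

section GridValue

variable {T : ℝ} {N k : ℕ} {v : ℕ → ℝ → ℝ} {s : ℝ}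

lemma abs_le_one_of_monotone {c : ℝ → ℝ} (hc : Monotone c)
    (h0 : ∀ k ≤ N, v k 0 = 1 - 2 * k / N)
    (hv : ∀ k ≤ N, ∀ s ∈ Icc 0 T,
      HasDerivWithinAt (v k) (gridField N (fun j => c (v j s)) k) (Icc 0 T) s) :
    ∀ k ≤ N, ∀ s ∈ Icc 0 T, |v k s| ≤ 1 := by
  simp only [← Finset.mem_range_succ_iff] at hv h0
  have hdatum : ∀ k ∈ Finset.range (N + 1), |v k 0| ≤ 1 := fun k hk =>
    h0 k hk ▸ abs_one_sub_two_mul_div_le (Finset.mem_range_succ_iff.1 hk)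
  have hupper := le_of_deriv_nonpos_of_isMax hv (fun k hk => le_of_abs_le (hdatum k hk))
    fun k hk s _ hmax => gridField_nonpos (Finset.mem_range_succ_iff.1 hk) fun j hj =>
      hc (hmax j (Finset.mem_range_succ_iff.2 hj))
  have hlower := le_of_deriv_nonpos_of_isMax (w := fun k s => -v k s)
    (fun k hk s hs => (hv k hk s hs).neg)
    (fun k hk => neg_le_of_neg_le (neg_le_of_abs_le (hdatum k hk)))
    fun k hk s _ hmax => neg_nonpos.2 (gridField_nonneg fun j hj =>
      hc (neg_le_neg_iff.1 (hmax j (Finset.mem_range_succ_iff.2 hj))))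
  exact fun k hk s hs => abs_le'.2 ⟨hupper k (Finset.mem_range_succ_iff.2 hk) s hs,
    hlower k (Finset.mem_range_succ_iff.2 hk) s hs⟩

lemma IsGridValue.abs_le_one (hv : IsGridValue T N v) : ∀ k ≤ N, ∀ s ∈ Icc 0 T, |v k s| ≤ 1 :=
  abs_le_one_of_monotone monotone_id hv.initial hv.deriv

lemma IsGridValue.initial_le_reflect (hv : IsGridValue T N v) (hk : k ≤ N) (hkN : N ≤ 2 * k) :
    v k 0 ≤ v (N - k) 0 := by
  rw [hv.initial k hk, hv.initial (N - k) (by omega)]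
  gcongr
  omega

lemma IsGridValue.initial_succ_le (hv : IsGridValue T N v) (hk : k < N) : v (k + 1) 0 ≤ v k 0 := by
  rw [hv.initial (k + 1) hk, hv.initial k hk.le]
  gcongr
  omega

/-- The system is quasi-positive for the increments in the state of the player and in the state of
the others, taken together. -/
lemma IsGridValue.le_reflect_and_succ_le (hv : IsGridValue T N v) :
    (∀ k ≤ N, N ≤ 2 * k → ∀ s ∈ Icc 0 T, v k s ≤ v (N - k) s) ∧
    (∀ k < N, N ≤ 2 * k → ∀ s ∈ Icc 0 T, v (k + 1) s ≤ v k s) := by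
  let F (s : ℝ) : ℕ → ℝ := gridField N fun j => v j s
  let state : Finset ℕ := {k ∈ Finset.range (N + 1) | N ≤ 2 * k}
  let succ : Finset ℕ := {k ∈ Finset.range N | N ≤ 2 * k}
  have hmem_state (k : ℕ) : k ∈ state ↔ k ≤ N ∧ N ≤ 2 * k := by simp [state]
  have hmem_succ (k : ℕ) : k ∈ succ ↔ k < N ∧ N ≤ 2 * k := by simp [succ]
  have hnonpos := nonpos_of_deriv_le_mul_of_isMax (T := T) (L := 6 * N + 2)
    (S := state.disjSum succ)
    (w := Sum.elim (fun k s => v k s - v (N - k) s) (fun k s => v (k + 1) s - v k s))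
    (w' := Sum.elim (fun k s => F s k - F s (N - k)) (fun k s => F s (k + 1) - F s k))
    ?_ ?_ ?_
  · simp only [Sum.forall, Finset.inl_mem_disjSum, Finset.inr_mem_disjSum, hmem_state, hmem_succ,
      Sum.elim_inl, Sum.elim_inr, sub_nonpos, and_imp] at hnonpos
    exact hnonpos
  · rintro (k | k) hk s hs <;> simp only [Finset.inl_mem_disjSum, Finset.inr_mem_disjSum,
      hmem_state, hmem_succ] at hk
    · exact (hv.deriv k hk.1 s hs).sub (hv.deriv (N - k) (by omega) s hs)
    · exact (hv.deriv (k + 1) hk.1 s hs).sub (hv.deriv k hk.1.le s hs)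
  · rintro (k | k) hk <;> simp only [Finset.inl_mem_disjSum, Finset.inr_mem_disjSum,
      hmem_state, hmem_succ] at hk
    · exact sub_nonpos.2 (hv.initial_le_reflect hk.1 hk.2)
    · exact sub_nonpos.2 (hv.initial_succ_le hk.1)
  · intro i hi s hs hmax hpos
    simp only [Sum.forall, Finset.inl_mem_disjSum, Finset.inr_mem_disjSum, hmem_state, hmem_succ,
      Sum.elim_inl, Sum.elim_inr, and_imp] at hmax
    have hb (j : ℕ) (hj : j ≤ N) : |v j s| ≤ 1 := hv.abs_le_one j hj s hs
    rcases i with k | k <;> simp only [Finset.inl_mem_disjSum, Finset.inr_mem_disjSum, hmem_state,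
      hmem_succ, Sum.elim_inl, Sum.elim_inr] at hi hmax hpos ⊢
    · have hkN : N ≠ 2 * k := fun h => by
        rw [show N - k = k by omega, sub_self] at hpos
        exact hpos.false
      exact gridField_sub_reflect_le hpos.le hb hmax.1 (fun hk => hmax.2 k hk hi.2) hi.1
        (lt_of_le_of_ne hi.2 hkN) (sub_pos.1 hpos).le
    · exact gridField_succ_sub_le hpos.le hb hmax.1 (fun hk => hmax.2 (k + 1) hk (by omega))
        hi.1 hi.2 (sub_pos.1 hpos).le

lemma IsGridValue.le_reflect (hv : IsGridValue T N v) (hk : k ≤ N) (hkN : N ≤ 2 * k)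
    (hs : s ∈ Icc 0 T) : v k s ≤ v (N - k) s :=
  hv.le_reflect_and_succ_le.1 k hk hkN s hs

/-- The closed system at `k ≥ N / 2` reduces to this field when the others in state `1` do not
flip; `p k` and `q k` stand for the values at `k / N` of a player in the majority state and of one
in the minority state. -/
def majorityField (N : ℕ) (p q : ℕ → ℝ) (k : ℕ) : ℝ :=
  ((N - k : ℕ) : ℝ) * (q (k + 1) - p (k + 1)) * (p (k + 1) - p k)

/-- The field of the reduced system for a player in the minority state, see `majorityField`. -/
def minorityField (N : ℕ) (p q : ℕ → ℝ) (k : ℕ) : ℝ :=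
  -((q k - p k) ^ 2 / 2) + ((N - k : ℕ) : ℝ) * (q k - p k) * (q (k + 1) - q k)

lemma IsGridValue.hasDerivWithinAt_majority (hv : IsGridValue T N v) (hk : k ≤ N)
    (hkN : N ≤ 2 * k) (hs : s ∈ Icc 0 T) :
    HasDerivWithinAt (v k) (majorityField N (fun j => v j s) (fun j => v (N - j) s) k)
      (Icc 0 T) s := by
  convert hv.deriv k hk s hs using 1
  unfold majorityField gridField ham
  rw [negPart_sub_of_ge (hv.le_reflect hk hkN hs)]
  rcases hk.eq_or_lt with rfl | hk
  · simp
  · rw [negPart_sub_of_le (hv.le_reflect hk (by omega) hs)]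
    ring

lemma IsGridValue.hasDerivWithinAt_minority (hv : IsGridValue T N v) (hk : k ≤ N)
    (hkN : N < 2 * k) (hs : s ∈ Icc 0 T) :
    HasDerivWithinAt (v (N - k)) (minorityField N (fun j => v j s) (fun j => v (N - j) s) k
      + k * (v (N - (k - 1)) s - v (k - 1) s)⁻ * (v (N - (k - 1)) s - v (N - k) s))
      (Icc 0 T) s := by
  convert hv.deriv (N - k) (by omega) s hs using 1
  unfold minorityField gridField ham
  rw [show N - (N - k) = k by omega, show N - k - 1 = N - (k + 1) by omega,
    show N - k + 1 = N - (k - 1) by omega, show N - (N - (k - 1)) = k - 1 by omega,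
    negPart_sub_of_le (hv.le_reflect hk hkN.le hs)]

lemma IsGridValue.hasDerivWithinAt_minority_of_le (hv : IsGridValue T N v) (hk : k ≤ N)
    (hk0 : 0 < k) (hkN : N ≤ 2 * (k - 1)) (hs : s ∈ Icc 0 T) :
    HasDerivWithinAt (v (N - k)) (minorityField N (fun j => v j s) (fun j => v (N - j) s) k)
      (Icc 0 T) s := by
  convert hv.hasDerivWithinAt_minority hk (by omega) hs using 1
  rw [negPart_sub_of_ge (hv.le_reflect (by omega) hkN hs)]
  ring

/-- Next to `1 / 2` all the others flip, which damps the jump of the value there. -/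
lemma IsGridValue.hasDerivWithinAt_center (hv : IsGridValue T N v) (hN : N + 1 = 2 * k)
    (hs : s ∈ Icc 0 T) :
    HasDerivWithinAt (v (N - k)) (minorityField N (fun j => v j s) (fun j => v (N - j) s) k
      - k * (v (N - k) s - v k s) ^ 2) (Icc 0 T) s := by
  convert hv.hasDerivWithinAt_minority (k := k) (by omega) (by omega) hs using 1
  rw [show N - (k - 1) = k by omega, show k - 1 = N - k by omega,
    negPart_sub_of_le (hv.le_reflect (by omega) (by omega) hs)]
  ring

end GridValue

section Comparison

variable {σ c z z' d d' δ A : ℝ}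

lemma mul_le_abs_of_abs_eq_one (hσ : |σ| = 1) (y : ℝ) : σ * y ≤ |y| :=
  (le_abs_self _).trans (by rw [abs_mul, hσ, one_mul])

lemma transport_sub_le (hσ : |σ| = 1) (hc : 0 ≤ c) (hz : 0 ≤ z) (hδ : |z - z'| ≤ δ)
    (hd : |c * d'| ≤ A) (hdd : σ * (d - d') ≤ 0) : σ * (c * z * d - c * z' * d') ≤ δ * A := by
  have hfrozen : c * z * (σ * (d - d')) ≤ 0 :=
    mul_nonpos_of_nonneg_of_nonpos (mul_nonneg hc hz) hdd
  have hspeed : σ * ((z - z') * (c * d')) ≤ δ * A := by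
    refine (mul_le_abs_of_abs_eq_one hσ _).trans ?_
    have := (abs_nonneg _).trans hδ
    rw [abs_mul]
    gcongr
  linarith

lemma half_sq_sub_le (hσ : |σ| = 1) (hδ : |z - z'| ≤ δ) (hz : |z| ≤ 2) (hz' : |z'| ≤ 2) :
    σ * (z' ^ 2 / 2 - z ^ 2 / 2) ≤ 2 * δ := by
  have hsum : |z + z'| ≤ 4 := (abs_add_le z z').trans (by linarith)
  calc σ * (z' ^ 2 / 2 - z ^ 2 / 2) ≤ |z' ^ 2 / 2 - z ^ 2 / 2| := mul_le_abs_of_abs_eq_one hσ _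
    _ = |z - z'| * |z + z'| / 2 := by
      rw [← abs_mul, ← abs_neg, ← abs_two (α := ℝ), ← abs_div, abs_two]
      ring_nf
    _ ≤ δ * 4 / 2 := by
      have := (abs_nonneg _).trans hδ
      gcongr
    _ = 2 * δ := by ring

/-- `p` and `q` solve the reduced system of `majorityField` and `minorityField` on the grid points
`k / N ≥ k₀ / N` up to an error `R` in the equation, with discrete derivatives of size `A`. -/
structure IsReducedApprox (T : ℝ) (N k₀ : ℕ) (A R : ℝ) (p q : ℕ → ℝ → ℝ) : Prop where
  initial_majority : ∀ k ∈ Finset.Icc k₀ N, p k 0 = 1 - 2 * k / N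
  initial_minority : ∀ k ∈ Finset.Icc k₀ N, q k 0 = -(1 - 2 * k / N)
  abs_sub_le_two : ∀ k ∈ Finset.Icc k₀ N, ∀ s ∈ Icc 0 T, |q k s - p k s| ≤ 2
  increment_majority : ∀ k ∈ Finset.Ico k₀ N, ∀ s ∈ Icc 0 T, N * |p (k + 1) s - p k s| ≤ A
  increment_minority : ∀ k ∈ Finset.Ico k₀ N, ∀ s ∈ Icc 0 T, N * |q (k + 1) s - q k s| ≤ A
  deriv_majority : ∀ k ∈ Finset.Icc k₀ N, ∀ s ∈ Icc 0 T, ∃ p',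
    HasDerivWithinAt (p k) p' (Icc 0 T) s ∧
      |p' - majorityField N (fun j => p j s) (fun j => q j s) k| ≤ R
  deriv_minority : ∀ k ∈ Finset.Icc k₀ N, ∀ s ∈ Icc 0 T, ∃ q',
    HasDerivWithinAt (q k) q' (Icc 0 T) s ∧
      |q' - minorityField N (fun j => p j s) (fun j => q j s) k| ≤ R

variable {T R η s : ℝ} {N k k₀ : ℕ}

section Fields

variable {x y p q : ℕ → ℝ}

lemma majorityField_sub_le (hσ : |σ| = 1) (hη : 0 ≤ η) (hA : 0 ≤ A)
    (hx : k < N → |x (k + 1) - p (k + 1)| ≤ η) (hy : k < N → |y (k + 1) - q (k + 1)| ≤ η)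
    (hmax : σ * (x k - p k) = η) (hxy : k < N → x (k + 1) ≤ y (k + 1))
    (hp : k < N → N * |p (k + 1) - p k| ≤ A) :
    σ * (majorityField N x y k - majorityField N p q k) ≤ 2 * η * A := by
  unfold majorityField
  rcases lt_or_ge k N with hk | hk
  · have hzero : σ * (x (k + 1) - p (k + 1)) ≤ η := (mul_le_abs_of_abs_eq_one hσ _).trans (hx hk)
    refine transport_sub_le hσ (Nat.cast_nonneg _) (sub_nonneg.2 (hxy hk)) ?_ ?_ (by linarith)
    · rw [sub_sub_sub_comm, two_mul]
      exact (abs_sub _ _).trans (add_le_add (hy hk) (hx hk))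
    · rw [abs_mul, Nat.abs_cast]
      refine le_trans ?_ (hp hk)
      have := natCast_sub_le N k
      gcongr
  · simp only [Nat.sub_eq_zero_of_le hk, Nat.cast_zero, zero_mul, sub_self, mul_zero]
    positivity

lemma minorityField_sub_le (hσ : |σ| = 1) (hη : 0 ≤ η) (hA : 0 ≤ A)
    (hx : |x k - p k| ≤ η) (hy : k < N → |y (k + 1) - q (k + 1)| ≤ η)
    (hmax : σ * (y k - q k) = η) (hyk : |y k - q k| ≤ η) (hxy : x k ≤ y k)
    (hz : |y k - x k| ≤ 2) (hz' : |q k - p k| ≤ 2) (hq : k < N → N * |q (k + 1) - q k| ≤ A) :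
    σ * (minorityField N x y k - minorityField N p q k) ≤ 2 * η * A + 4 * η := by
  have hδ : |(y k - x k) - (q k - p k)| ≤ 2 * η := by
    rw [sub_sub_sub_comm, two_mul]
    exact (abs_sub _ _).trans (add_le_add hyk hx)
  have hsq := half_sq_sub_le hσ hδ hz hz'
  have htransport : σ * (((N - k : ℕ) : ℝ) * (y k - x k) * (y (k + 1) - y k)
      - ((N - k : ℕ) : ℝ) * (q k - p k) * (q (k + 1) - q k)) ≤ 2 * η * A := by
    rcases lt_or_ge k N with hk | hk
    · have hone : σ * (y (k + 1) - q (k + 1)) ≤ η := (mul_le_abs_of_abs_eq_one hσ _).trans (hy hk)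
      refine transport_sub_le hσ (Nat.cast_nonneg _) (sub_nonneg.2 hxy) hδ ?_ (by linarith)
      rw [abs_mul, Nat.abs_cast]
      refine le_trans ?_ (hq hk)
      have := natCast_sub_le N k
      gcongr
    · simp only [Nat.sub_eq_zero_of_le hk, Nat.cast_zero, zero_mul, sub_self, mul_zero]
      positivity
  unfold minorityField
  linarith

end Fields

variable {v p q : ℕ → ℝ → ℝ} {e : ℝ}

lemma IsGridValue.majority_error_le (hv : IsGridValue T N v)
    (hpq : IsReducedApprox T N k₀ A R p q) (hk₀N : N ≤ 2 * k₀) (hA : 0 ≤ A) (hσ : |σ| = 1)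
    (hη : 0 ≤ η) (hk : k ∈ Finset.Icc k₀ N) (hs : s ∈ Icc 0 T)
    (hx : ∀ j ∈ Finset.Icc k₀ N, |v j s - p j s| ≤ η)
    (hy : ∀ j ∈ Finset.Icc k₀ N, |v (N - j) s - q j s| ≤ η) (hmax : σ * (v k s - p k s) = η)
    (he : |e - majorityField N (fun j => p j s) (fun j => q j s) k| ≤ R) :
    σ * (majorityField N (fun j => v j s) (fun j => v (N - j) s) k - e)
      ≤ (2 * A + 4) * η + R := by
  have hk₀k := (Finset.mem_Icc.1 hk).1
  have hsucc (h : k < N) : k + 1 ∈ Finset.Icc k₀ N := Finset.mem_Icc.2 ⟨by omega, h⟩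
  have hfield := majorityField_sub_le (x := fun j => v j s) (y := fun j => v (N - j) s)
    (p := fun j => p j s) (q := fun j => q j s) hσ hη hA (fun h => hx _ (hsucc h))
    (fun h => hy _ (hsucc h)) hmax (fun h => hv.le_reflect h (by omega) hs)
    fun h => hpq.increment_majority k (Finset.mem_Ico.2 ⟨hk₀k, h⟩) s hs
  have herror := (mul_le_abs_of_abs_eq_one hσ _).trans ((abs_sub_comm _ _).trans_le he)
  linarith

lemma IsGridValue.minority_error_le (hv : IsGridValue T N v)
    (hpq : IsReducedApprox T N k₀ A R p q) (hk₀N : N ≤ 2 * k₀) (hA : 0 ≤ A) (hσ : |σ| = 1)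
    (hη : 0 ≤ η) (hk : k ∈ Finset.Icc k₀ N) (hs : s ∈ Icc 0 T)
    (hx : ∀ j ∈ Finset.Icc k₀ N, |v j s - p j s| ≤ η)
    (hy : ∀ j ∈ Finset.Icc k₀ N, |v (N - j) s - q j s| ≤ η)
    (hmax : σ * (v (N - k) s - q k s) = η)
    (he : |e - minorityField N (fun j => p j s) (fun j => q j s) k| ≤ R) :
    σ * (minorityField N (fun j => v j s) (fun j => v (N - j) s) k - e)
      ≤ (2 * A + 4) * η + R := by
  obtain ⟨hk₀k, hkN⟩ := Finset.mem_Icc.1 hk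
  have hfield := minorityField_sub_le (x := fun j => v j s) (y := fun j => v (N - j) s)
    (p := fun j => p j s) (q := fun j => q j s) hσ hη hA (hx k hk)
    (fun h => hy _ (Finset.mem_Icc.2 ⟨by omega, h⟩)) hmax (hy k hk)
    (hv.le_reflect hkN (by omega) hs)
    (abs_sub_le_two (hv.abs_le_one _ (N.sub_le k) s hs) (hv.abs_le_one k hkN s hs))
    (hpq.abs_sub_le_two k hk s hs)
    fun h => hpq.increment_minority k (Finset.mem_Ico.2 ⟨hk₀k, h⟩) s hs
  have herror := (mul_le_abs_of_abs_eq_one hσ _).trans ((abs_sub_comm _ _).trans_le he)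
  linarith

lemma IsGridValue.abs_sub_le (hv : IsGridValue T N v)
    (hpq : IsReducedApprox T N k₀ A R p q) (hk₀ : 0 < k₀) (hk₀N : N ≤ 2 * (k₀ - 1))
    (hA : 0 ≤ A) (hR : 0 ≤ R) (hk : k ∈ Finset.Icc k₀ N) (hs : s ∈ Icc 0 T) :
    |v k s - p k s| ≤ R * Real.exp ((2 * A + 5) * T) ∧
      |v (N - k) s - q k s| ≤ R * Real.exp ((2 * A + 5) * T) := by
  choose! p' hp' hpR using hpq.deriv_majority
  choose! q' hq' hqR using hpq.deriv_minority
  have hbound := abs_le_mul_exp_of_deriv_le_of_isMax (T := T) (L := 2 * A + 4) (a := R)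
    (S := (Finset.Icc k₀ N).disjSum (Finset.Icc k₀ N))
    (w := Sum.elim (fun k s => v k s - p k s) (fun k s => v (N - k) s - q k s))
    (w' := Sum.elim
      (fun k s => majorityField N (fun j => v j s) (fun j => v (N - j) s) k - p' k s)
      (fun k s => minorityField N (fun j => v j s) (fun j => v (N - j) s) k - q' k s))
    (by positivity) hR ?_ ?_ ?_
  · rw [show 2 * A + 4 + 1 = 2 * A + 5 by ring] at hbound
    exact ⟨hbound (.inl k) (Finset.inl_mem_disjSum.2 hk) s hs,
      hbound (.inr k) (Finset.inr_mem_disjSum.2 hk) s hs⟩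
  · rintro (k | k) hk s hs <;>
      simp only [Finset.inl_mem_disjSum, Finset.inr_mem_disjSum] at hk <;>
      obtain ⟨hk₀k, hkN⟩ := Finset.mem_Icc.1 hk
    · exact (hv.hasDerivWithinAt_majority hkN (by omega) hs).sub (hp' k hk s hs)
    · exact (hv.hasDerivWithinAt_minority_of_le hkN (by omega) (by omega) hs).sub (hq' k hk s hs)
  · rintro (k | k) hk <;>
      simp only [Finset.inl_mem_disjSum, Finset.inr_mem_disjSum, Sum.elim_inl, Sum.elim_inr,
        sub_eq_zero] at hk ⊢ <;>
      obtain ⟨hk₀k, hkN⟩ := Finset.mem_Icc.1 hk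
    · rw [hv.initial k hkN, hpq.initial_majority k hk]
    · have : (N : ℝ) ≠ 0 := Nat.cast_ne_zero.2 (by omega)
      rw [hv.initial (N - k) (by omega), hpq.initial_minority k hk, Nat.cast_sub hkN]
      field_simp
      ring
  · intro i hi s hs σ hσ hmax
    simp only [Sum.forall, Finset.inl_mem_disjSum, Finset.inr_mem_disjSum, Sum.elim_inl,
      Sum.elim_inr] at hmax
    have hη := (abs_nonneg _).trans (hmax.1 k hk)
    rcases i with k | k <;>
      simp only [Finset.inl_mem_disjSum, Finset.inr_mem_disjSum] at hi
    · exact hv.majority_error_le hpq (by omega) hA hσ hη hi hs hmax.1 hmax.2 rfl (hpR k hi s hs)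
    · exact hv.minority_error_le hpq (by omega) hA hσ hη hi hs hmax.1 hmax.2 rfl (hqR k hi s hs)

end Comparison

section Existence

lemma exists_hasDerivWithinAt_of_lipschitz_of_bounded {E : Type*} [NormedAddCommGroup E]
    [NormedSpace ℝ E] [CompleteSpace E] {F : E → E} {K : NNReal} {B T : ℝ}
    (hF : LipschitzWith K F) (hB : ∀ x, ‖F x‖ ≤ B) (hT : 0 ≤ T) (x₀ : E) :
    ∃ α : ℝ → E, α 0 = x₀ ∧ ∀ s ∈ Icc 0 T, HasDerivWithinAt α (F (α s)) (Icc 0 T) s := by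
  lift T to NNReal using hT
  lift B to NNReal using (norm_nonneg _).trans (hB x₀)
  have hPL : IsPicardLindelof (fun _ => F) (tmin := 0) (tmax := T) ⟨0, left_mem_Icc.2 T.2⟩ x₀
      (B * T) 0 B K :=
    { lipschitzOnWith := fun _ _ => hF.lipschitzOnWith
      continuousOn := fun _ _ => continuousOn_const
      norm_le := fun _ _ x _ => hB x
      mul_max_le := by simp }
  exact hPL.exists_eq_forall_mem_Icc_hasDerivWithinAt₀

lemma exists_hasDerivWithinAt_comp_projIcc {ι : Type*} [Fintype ι] {F : (ι → ℝ) → ι → ℝ}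
    (hF : ∀ i, LocallyLipschitz fun x => F x i) {a b T : ℝ} (hab : a ≤ b) (hT : 0 ≤ T)
    (x₀ : ι → ℝ) :
    ∃ α : ℝ → ι → ℝ, α 0 = x₀ ∧ ∀ s ∈ Icc 0 T,
      HasDerivWithinAt α (F fun i => projIcc a b hab (α s i)) (Icc 0 T) s := by
  let P (x : ι → ℝ) (i : ι) : ℝ := projIcc a b hab (x i)
  have hPmem (x : ι → ℝ) : P x ∈ Icc (fun _ => a) (fun _ => b) :=
    ⟨fun i => (projIcc a b hab (x i)).2.1, fun i => (projIcc a b hab (x i)).2.2⟩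
  have hPlip : LipschitzWith 1 P := LipschitzWith.of_edist_le fun x y =>
    edist_pi_le_iff.2 fun i =>
      ((LipschitzWith.projIcc hab (x i) (y i)).trans_eq (one_mul _)).trans
        (edist_le_pi_edist x y i)
  choose K hK using fun i => (hF i).locallyLipschitzOn.exists_lipschitzOnWith_of_compact
    (isCompact_Icc (a := fun _ : ι => a) (b := fun _ => b))
  have hFlip : LipschitzOnWith (Finset.univ.sup K) F (Icc (fun _ => a) (fun _ => b)) :=
    fun x hx y hy => edist_pi_le_iff.2 fun i => (hK i hx hy).trans <| by
      gcongr
      exact Finset.le_sup (Finset.mem_univ i)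
  obtain ⟨B, hB⟩ := isCompact_Icc.exists_bound_of_continuousOn hFlip.continuousOn
  exact exists_hasDerivWithinAt_of_lipschitz_of_bounded
    (lipschitzOnWith_univ.1 (hFlip.comp hPlip.lipschitzOnWith fun x _ => hPmem x))
    (fun x => hB _ (hPmem x)) hT x₀

lemma locallyLipschitz_gridField {X : Type*} [PseudoEMetricSpace X] {x : X → ℕ → ℝ}
    (hx : ∀ j, LocallyLipschitz fun e => x e j) (N k : ℕ) :
    LocallyLipschitz fun e => gridField N (x e) k := by
  have hsub (i j : ℕ) : LocallyLipschitz fun e => x e i - x e j := (hx i).sub (hx j)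
  have hrate (i j : ℕ) : LocallyLipschitz fun e => (x e i - x e j)⁻ :=
    lipschitzWith_negPart.locallyLipschitz.comp (hsub i j)
  have hpoly : LocallyLipschitz fun r : (ℝ × ℝ) × ℝ × ℝ =>
      -(r.1.1 ^ 2 / 2) + k * r.1.1 * r.2.1 + ((N - k : ℕ) : ℝ) * r.1.2 * r.2.2 :=
    ContDiff.locallyLipschitz (𝕂 := ℝ) (by fun_prop)
  have hdata := ((hrate (N - k) k).prodMk (hrate (k + 1) (N - (k + 1)))).prodMk
    ((hsub (k - 1) k).prodMk (hsub (k + 1) k))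
  simpa only [gridField, ham, Function.comp_def] using hpoly.comp hdata

lemma exists_isGridValue {T : ℝ} (hT : 0 ≤ T) (N : ℕ) : ∃ v, IsGridValue T N v := by
  have hab : (-1 : ℝ) ≤ 1 := by norm_num
  obtain ⟨α, hα0, hα⟩ := exists_hasDerivWithinAt_comp_projIcc
    (F := fun x (k : Fin (N + 1)) => gridField N (fun j => x (Fin.clamp j N)) k)
    (fun k => locallyLipschitz_gridField
      (fun j => (LipschitzWith.eval (Fin.clamp j N)).locallyLipschitz) N k)
    hab hT fun k => 1 - 2 * (k : ℕ) / N
  let v (j : ℕ) (s : ℝ) : ℝ := α s (Fin.clamp j N)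
  have hclamp {k : ℕ} (hk : k ≤ N) : (Fin.clamp k N : ℕ) = k := min_eq_left hk
  have hv0 : ∀ k ≤ N, v k 0 = 1 - 2 * k / N := fun k hk => by
    simp only [v, hα0, hclamp hk]
  have hv : ∀ k ≤ N, ∀ s ∈ Icc 0 T,
      HasDerivWithinAt (v k) (gridField N (fun j => projIcc (-1) 1 hab (v j s)) k) (Icc 0 T) s :=
    fun k hk s hs => by
      simpa only [hclamp hk] using hasDerivWithinAt_pi.1 (hα s hs) (Fin.clamp k N)
  have hbound (j : ℕ) (s : ℝ) (hs : s ∈ Icc 0 T) : |v j s| ≤ 1 := by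
    have hmono := abs_le_one_of_monotone (monotone_projIcc hab) hv0 hv (min j N)
      (min_le_right _ _) s hs
    rwa [show v (min j N) s = v j s by simp [v, Fin.clamp]] at hmono
  refine ⟨v, hv0, fun k hk s hs => ?_⟩
  simpa only [projIcc_of_mem hab (abs_le.1 (hbound _ s hs))] using hv k hk s hs


lemma gridField_comp_div {N k : ℕ} (hN : 0 < N) (hk : k ≤ N) (x : ℝ → ℝ) :
    gridField N (fun j => x (j / N)) k =
      -ham (x (1 - k / N) - x (k / N))
      + N * (k / N) * (x (1 - k / N) - x (k / N))⁻ * (x (k / N - 1 / N) - x (k / N))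
      + N * (1 - k / N) * (x (k / N + 1 / N) - x (1 - k / N - 1 / N))⁻
        * (x (k / N + 1 / N) - x (k / N)) := by
  have hreflect {j : ℕ} (hj : j ≤ N) : ((N - j : ℕ) : ℝ) / N = 1 - j / N := by
    rw [Nat.cast_sub hj]
    field_simp
  have hsucc : ((k + 1 : ℕ) : ℝ) / N = k / N + 1 / N := by
    push_cast
    ring
  have hdown : (N : ℝ) * (k / N) = k := by field_simp
  have hup : (N : ℝ) * (1 - k / N) = ((N - k : ℕ) : ℝ) := by
    rw [Nat.cast_sub hk]
    field_simp
  unfold gridField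
  simp only [hreflect hk, hsucc, hdown, hup]
  congr 1
  · rcases Nat.eq_zero_or_pos k with rfl | hk0
    · simp
    · rw [Nat.cast_pred hk0, sub_div]
  · rcases hk.eq_or_lt with rfl | hk
    · simp
    · rw [hreflect (j := k + 1) hk, hsucc, sub_add_eq_sub_sub]

variable {T : ℝ} {N : ℕ}

lemma sub_mem_Icc_zero {s : ℝ} (hs : s ∈ Icc 0 T) : T - s ∈ Icc 0 T :=
  ⟨sub_nonneg.2 hs.2, sub_le_self T hs.1⟩

lemma hasDerivWithinAt_comp_const_sub_Icc {f : ℝ → ℝ} {f' s : ℝ}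
    (h : HasDerivWithinAt f f' (Icc 0 T) (T - s)) :
    HasDerivWithinAt (fun s => f (T - s)) (-f') (Icc 0 T) s := by
  have hreverse : HasDerivWithinAt (fun s : ℝ => T - s) (-1) (Icc 0 T) s :=
    ((hasDerivAt_id s).const_sub T).hasDerivWithinAt
  simpa [Function.comp_def] using h.scomp s hreverse fun _ => sub_mem_Icc_zero

lemma IsNashValue.isGridValue (hN : 0 < N) {V : ℝ → ℝ → ℝ} (hV : IsNashValue T N V) :
    IsGridValue T N (fun k s => V (T - s) (k / N)) where
  initial k hk := by
    rw [sub_zero, hV.terminal (k / N) ⟨k, hk, rfl⟩]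
    ring
  deriv k hk s hs := by
    have hderiv := (hV.diff (k / N) ⟨k, hk, rfl⟩ _ (sub_mem_Icc_zero hs)).hasDerivWithinAt
    have hequation := hV.equation _ (sub_mem_Icc_zero hs) (k / N) ⟨k, hk, rfl⟩
    refine (hasDerivWithinAt_comp_const_sub_Icc hderiv).congr_deriv ?_
    rw [gridField_comp_div hN hk (V (T - s))]
    linarith

lemma exists_isNashValue (hT : 0 < T) (hN : 0 < N) : ∃ V, IsNashValue T N V := by
  obtain ⟨v, hv⟩ := exists_isGridValue hT.le N
  let V (t μ : ℝ) : ℝ := v ⌊μ * N⌋₊ (T - t)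
  have hVgrid (t : ℝ) (k : ℕ) : V t (k / N) = v k (T - t) := by
    simp only [V, div_mul_cancel₀ (k : ℝ) (Nat.cast_ne_zero.2 hN.ne'), Nat.floor_natCast]
  have hderiv : ∀ k ≤ N, ∀ t ∈ Icc 0 T, HasDerivWithinAt (fun t => V t (k / N))
      (-gridField N (fun j => V t (j / N)) k) (Icc 0 T) t := fun k hk t ht => by
    simp only [hVgrid]
    exact hasDerivWithinAt_comp_const_sub_Icc (hv.deriv k hk (T - t) (sub_mem_Icc_zero ht))
  refine ⟨V, ?_, ?_, ?_⟩
  · rintro μ ⟨k, hk, rfl⟩ t ht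
    exact (hderiv k hk t ht).differentiableWithinAt
  · rintro t ht μ ⟨k, hk, rfl⟩
    rw [(hderiv k hk t ht).derivWithin (uniqueDiffOn_Icc hT t ht),
      gridField_comp_div hN hk (V t)]
    ring
  · rintro μ ⟨k, hk, rfl⟩
    rw [hVgrid, sub_self, hv.initial k hk]
    ring

end Existence

/-! ### Classical solutions along characteristics -/

section PartialDerivatives

variable {f : ℝ → ℝ → ℝ} {L : ℝ × ℝ →L[ℝ] ℝ}

lemma hasDerivWithinAt_along_curve {S : Set (ℝ × ℝ)} {I : Set ℝ} {x : ℝ → ℝ} {x' s : ℝ}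
    (hf : HasFDerivWithinAt (fun p : ℝ × ℝ => f p.1 p.2) L S (s, x s))
    (hx : HasDerivWithinAt x x' I s) (hmaps : MapsTo (fun r => (r, x r)) I S) :
    HasDerivWithinAt (fun r => f r (x r)) (L (1, 0) + x' * L (0, 1)) I s := by
  refine (hf.comp_hasDerivWithinAt s ((hasDerivWithinAt_id s I).prodMk hx) hmaps).congr_deriv ?_
  have hsplit : ((1 : ℝ), x') = (1, 0) + x' • ((0 : ℝ), (1 : ℝ)) := by simp
  rw [hsplit, map_add, map_smul, smul_eq_mul]

variable {I J : Set ℝ} {t m : ℝ}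

lemma hasDerivWithinAt_fst (hf : HasFDerivWithinAt (fun p : ℝ × ℝ => f p.1 p.2) L (I ×ˢ J) (t, m))
    (hm : m ∈ J) : HasDerivWithinAt (fun s => f s m) (L (1, 0)) I t := by
  simpa using hasDerivWithinAt_along_curve (x := fun _ => m) hf (hasDerivWithinAt_const t I m)
    fun s hs => ⟨hs, hm⟩

lemma hasDerivWithinAt_snd (hf : HasFDerivWithinAt (fun p : ℝ × ℝ => f p.1 p.2) L (I ×ˢ J) (t, m))
    (ht : t ∈ I) : HasDerivWithinAt (f t) (L (0, 1)) J m :=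
  hf.comp_hasDerivWithinAt m ((hasDerivWithinAt_const m J t).prodMk (hasDerivWithinAt_id m J))
    fun _ hy => ⟨ht, hy⟩

end PartialDerivatives

lemma Ioc_mem_nhdsWithin_Icc {m : ℝ} (hm : m ∈ Ioc (0 : ℝ) 1) :
    Ioc (0 : ℝ) 1 ∈ 𝓝[Icc (-1) 1] m := by
  filter_upwards [mem_nhdsWithin_of_mem_nhds (Ioi_mem_nhds hm.1), self_mem_nhdsWithin]
    with y hpos hy using ⟨hpos, hy.2⟩

lemma hasDerivAt_mul_abs (x : ℝ) : HasDerivAt (fun x : ℝ => x * |x|) (2 * |x|) x := by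
  rcases eq_or_ne x 0 with rfl | hx
  · rw [hasDerivAt_iff_tendsto_slope]
    have habs : Tendsto (fun y : ℝ => |y|) (𝓝[≠] 0) (𝓝 (2 * |0|)) := by
      simpa using (continuous_abs.tendsto (0 : ℝ)).mono_left nhdsWithin_le_nhds
    refine habs.congr' ?_
    filter_upwards [self_mem_nhdsWithin] with y (hy : y ≠ 0)
    simp [slope_def_field, hy]
  · refine ((hasDerivAt_id x).mul (hasDerivAt_abs hx)).congr_deriv ?_
    simp only [id, self_mul_sign]
    ring

lemma hasDerivWithinAt_flux {f : ℝ → ℝ} {f' m : ℝ} {S : Set ℝ} (hf : HasDerivWithinAt f f' S m) :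
    HasDerivWithinAt (fun y => flux y (f y))
      (f m * |f m| / 2 + m * |f m| * f' - f m * f') S m := by
  have hmul_abs := (hasDerivAt_mul_abs (f m)).comp_hasDerivWithinAt m hf
  refine ((((hasDerivWithinAt_id m S).mul hmul_abs).div_const 2).sub
    ((hf.pow 2).div_const 2)).congr_deriv ?_
  simp
  ring

lemma hasDerivAt_charVal_time {t x : ℝ} (ht : 0 ≤ t) (hx : 0 ≤ x) :
    HasDerivAt (fun s => charVal s x) (-(charVal t x ^ 2 / 2)) t := by
  have hne : 1 + x * t ≠ 0 := by positivity
  have hfactor : HasDerivAt (fun s : ℝ => 1 + x * s) x t := by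
    simpa using ((hasDerivAt_id t).const_mul x).const_add 1
  refine ((hasDerivAt_const t (2 * x)).div hfactor hne).congr_deriv ?_
  unfold charVal
  field_simp
  ring

lemma hasDerivAt_charPos_time_charVal {t x : ℝ} (ht : 0 ≤ t) (hx : 0 ≤ x) :
    HasDerivAt (fun s => charPos s x) (-((1 - charPos t x) * charVal t x)) t := by
  refine (hasDerivAt_charPos_time t x).congr_deriv ?_
  have : 1 + x * t ≠ 0 := by positivity
  unfold charPos charVal
  field_simp
  ring

lemma mapsTo_charPos_charFoot {t m : ℝ} (hm : m ∈ Ioc (0 : ℝ) 1) :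
    MapsTo (fun s => charPos s (charFoot t m)) (Icc 0 t) (Ioc 0 1) := fun _ hs =>
  charPos_mem_of_le hs.1 hs.2 (Ioc_subset_Icc_self (charFoot_mem hm)) (charPos_charFoot_pos hm)

section ConservationLaw

variable {T : ℝ} {Z : ℝ → ℝ → ℝ}

lemma partials_eq_of_conservationLaw (hT : 0 < T) {L : ℝ × ℝ →L[ℝ] ℝ} {t m : ℝ} (ht : t ∈ Icc 0 T)
    (hm : m ∈ Ioc (0 : ℝ) 1)
    (hL : HasFDerivWithinAt (fun p : ℝ × ℝ => Z p.1 p.2) L (Icc 0 T ×ˢ Ioc 0 1) (t, m))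
    (hlaw : derivWithin (fun s => Z s m) (Icc 0 T) t
      + derivWithin (fun y => flux y (Z t y)) (Icc (-1) 1) m = 0) :
    L (1, 0) = (Z t m - m * |Z t m|) * L (0, 1) - Z t m * |Z t m| / 2 := by
  have hspace := (hasDerivWithinAt_flux (hasDerivWithinAt_snd hL ht)).mono_of_mem_nhdsWithin
    (Ioc_mem_nhdsWithin_Icc hm)
  rw [(hasDerivWithinAt_fst hL hm).derivWithin (uniqueDiffOn_Icc hT t ht), hspace.derivWithin
    (uniqueDiffOn_Icc (by norm_num) m ⟨by linarith [hm.1], hm.2⟩)] at hlaw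
  linear_combination hlaw

lemma abs_charVal_defect_le {A B z ζ b y : ℝ} (hz : |z| ≤ A) (hζ : ζ ∈ Icc (0 : ℝ) 2)
    (hb : |b| ≤ B) (hy : y ∈ Icc (0 : ℝ) 1) :
    |-(z * |z| - ζ * ζ) / 2 - b * (y * (|z| - ζ) - (z - ζ))|
      ≤ ((A + 2) / 2 + 2 * B) * |z - ζ| := by
  have habs : |(|z| - ζ)| ≤ |z - ζ| := by
    simpa only [abs_of_nonneg hζ.1] using abs_abs_sub_abs_le_abs_sub z ζ
  have hsquares : |z * |z| - ζ * ζ| ≤ (A + 2) * |z - ζ| := calc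
    |z * |z| - ζ * ζ| = |(z - ζ) * |z| + ζ * (|z| - ζ)| := by ring_nf
    _ ≤ |z - ζ| * |z| + ζ * |(|z| - ζ)| := by
      simpa only [abs_mul, abs_abs, abs_of_nonneg hζ.1] using
        abs_add_le ((z - ζ) * |z|) (ζ * (|z| - ζ))
    _ ≤ |z - ζ| * A + 2 * |z - ζ| := by gcongr; exact hζ.2
    _ = (A + 2) * |z - ζ| := by ring
  have hslope : |y * (|z| - ζ) - (z - ζ)| ≤ 2 * |z - ζ| := calc
    |y * (|z| - ζ) - (z - ζ)| ≤ y * |(|z| - ζ)| + |z - ζ| := by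
      simpa only [abs_mul, abs_of_nonneg hy.1] using abs_sub (y * (|z| - ζ)) (z - ζ)
    _ ≤ 1 * |z - ζ| + |z - ζ| := by gcongr; exact hy.2
    _ = 2 * |z - ζ| := by ring
  have : 0 ≤ B := (abs_nonneg b).trans hb
  calc |-(z * |z| - ζ * ζ) / 2 - b * (y * (|z| - ζ) - (z - ζ))|
      ≤ |z * |z| - ζ * ζ| / 2 + |b| * |y * (|z| - ζ) - (z - ζ)| := by
        simpa only [abs_mul, abs_div, abs_neg, abs_two] using
          abs_sub (-(z * |z| - ζ * ζ) / 2) (b * (y * (|z| - ζ) - (z - ζ)))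
    _ ≤ (A + 2) * |z - ζ| / 2 + B * (2 * |z - ζ|) := by gcongr
    _ = ((A + 2) / 2 + 2 * B) * |z - ζ| := by ring

lemma eq_charVal_of_conservationLaw (hT : 0 < T)
    (hZ : ContDiffOn ℝ 1 (fun p : ℝ × ℝ => Z p.1 p.2) (Icc 0 T ×ˢ Ioc 0 1))
    (hlaw : ∀ t ∈ Icc 0 T, ∀ m ∈ Ioc (0 : ℝ) 1, derivWithin (fun s => Z s m) (Icc 0 T) t
      + derivWithin (fun y => flux y (Z t y)) (Icc (-1) 1) m = 0)
    (hdatum : ∀ m ∈ Ioc (0 : ℝ) 1, Z 0 m = 2 * m) {t m : ℝ} (ht : t ∈ Icc 0 T)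
    (hm : m ∈ Ioc (0 : ℝ) 1) : Z t m = charVal t (charFoot t m) := by
  set S : Set (ℝ × ℝ) := Icc 0 T ×ˢ Ioc 0 1
  set L := fderivWithin ℝ (fun p : ℝ × ℝ => Z p.1 p.2) S
  set x₀ := charFoot t m
  have hx₀ : x₀ ∈ Ioc (0 : ℝ) 1 := charFoot_mem hm
  have hx := mapsTo_charPos_charFoot (t := t) hm
  have hpath : ContinuousOn (fun s => (s, charPos s x₀)) (Icc 0 t) := continuousOn_id.prodMk
    fun s _ => (hasDerivAt_charPos_time s x₀).continuousAt.continuousWithinAt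
  have hmaps : MapsTo (fun s => (s, charPos s x₀)) (Icc 0 t) S :=
    fun s hs => ⟨⟨hs.1, hs.2.trans ht.2⟩, hx hs⟩
  have hunique : UniqueDiffOn ℝ S := (uniqueDiffOn_Icc hT).prod (uniqueDiffOn_Ioc 0 1)
  obtain ⟨A, hA⟩ := isCompact_Icc.exists_bound_of_continuousOn (hZ.continuousOn.comp hpath hmaps)
  obtain ⟨B, hB⟩ := isCompact_Icc.exists_bound_of_continuousOn
    (((hZ.continuousOn_fderivWithin hunique le_rfl).clm_apply
      (continuousOn_const (c := ((0 : ℝ), (1 : ℝ))))).comp hpath hmaps)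
  have hderiv : ∀ s ∈ Icc 0 t, HasDerivWithinAt (fun s => Z s (charPos s x₀) - charVal s x₀)
      (-(Z s (charPos s x₀) * |Z s (charPos s x₀)| - charVal s x₀ * charVal s x₀) / 2
        - L (s, charPos s x₀) (0, 1) * (charPos s x₀ * (|Z s (charPos s x₀)| - charVal s x₀)
          - (Z s (charPos s x₀) - charVal s x₀))) (Icc 0 t) s := fun s hs => by
    have hL := (hZ.differentiableOn one_ne_zero _ (hmaps hs)).hasFDerivWithinAt
    refine ((hasDerivWithinAt_along_curve hL (hasDerivAt_charPos_time_charVal hs.1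
      hx₀.1.le).hasDerivWithinAt hmaps).sub
      (hasDerivAt_charVal_time hs.1 hx₀.1.le).hasDerivWithinAt).congr_deriv ?_
    linear_combination partials_eq_of_conservationLaw hT (hmaps hs).1 (hmaps hs).2 hL
      (hlaw s (hmaps hs).1 _ (hmaps hs).2)
  have hzero := eq_zero_of_abs_deriv_le_mul_abs_self_of_eq_zero_right
    (fun s hs => (hderiv s hs).continuousWithinAt)
    (fun s hs => (hderiv s (Ico_subset_Icc_self hs)).mono_of_mem_nhdsWithin
      (Icc_mem_nhdsGE_of_mem hs))
    (by simp [charPos_zero_left, hdatum x₀ hx₀, charVal])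
    (fun s hs => abs_charVal_defect_le (hA s (Ico_subset_Icc_self hs))
      ⟨charVal_nonneg hs.1 hx₀.1.le, (charVal_le hs.1 hx₀.1.le).trans (by linarith [hx₀.2])⟩
      (hB s (Ico_subset_Icc_self hs)) (Ioc_subset_Icc_self (hx (Ico_subset_Icc_self hs))))
    t (right_mem_Icc.2 ht.1)
  rw [charPos_charFoot hm] at hzero
  exact sub_eq_zero.1 hzero

end ConservationLaw

section Transport

lemma derivWithin_comp_add_two_mul {f : ℝ → ℝ} {f' m : ℝ} (hm : m ∈ Ioc (0 : ℝ) 1)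
    (hf : HasDerivWithinAt f f' (Ioc 0 1) m) :
    derivWithin (fun r => f (m + 2 * r)) (Ici 0) 0 * ((1 - m) / 2) = (1 - m) * f' := by
  rcases hm.2.eq_or_lt with rfl | hm1
  · ring
  · have hspace : HasDerivAt f f' (m + 2 * 0) := by
      simpa using hf.hasDerivAt (Ioc_mem_nhds hm.1 hm1)
    have hshift : HasDerivAt (fun r : ℝ => m + 2 * r) 2 0 := by
      simpa using ((hasDerivAt_id (0 : ℝ)).const_mul 2).const_add m
    have hcomp : HasDerivAt (fun r => f (m + 2 * r)) (f' * 2) 0 :=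
      HasDerivAt.comp (h := fun r : ℝ => m + 2 * r) 0 hspace hshift
    rw [hcomp.hasDerivWithinAt.derivWithin (uniqueDiffOn_Ici 0 0 self_mem_Ici)]
    ring

variable {T : ℝ} {u : ℝ → ℝ → ℝ}

lemma partials_eq_of_transport (hT : 0 < T) {L : ℝ × ℝ →L[ℝ] ℝ} {s m c : ℝ} (hs : s ∈ Icc 0 T)
    (hm : m ∈ Ioc (0 : ℝ) 1)
    (hL : HasFDerivWithinAt (fun p : ℝ × ℝ => u (T - p.1) p.2) L (Icc 0 T ×ˢ Ioc 0 1) (s, m))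
    (hlaw : -derivWithin (fun s => u s m) (Icc 0 T) (T - s)
      - derivWithin (fun r => u (T - s) (m + 2 * r)) (Ici 0) 0 * c * ((1 - m) / 2) = 0) :
    L (1, 0) = (1 - m) * c * L (0, 1) := by
  have htime : HasDerivWithinAt (fun s => u s m) (-L (1, 0)) (Icc 0 T) (T - s) := by
    have hreversed : HasDerivWithinAt (fun r => u (T - r) m) (L (1, 0)) (Icc 0 T)
        (T - (T - s)) := by
      simpa using hasDerivWithinAt_fst (f := fun r => u (T - r)) hL hm
    simpa using hasDerivWithinAt_comp_const_sub_Icc hreversed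
  rw [htime.derivWithin (uniqueDiffOn_Icc hT _ (sub_mem_Icc_zero hs))] at hlaw
  have hspace := derivWithin_comp_add_two_mul hm
    (hasDerivWithinAt_snd (f := fun r => u (T - r)) hL hs)
  linear_combination hlaw + c * hspace

lemma eq_neg_charFoot_of_transport (hT : 0 < T)
    (hu : ContDiffOn ℝ 1 (fun p : ℝ × ℝ => u p.1 p.2) (Icc 0 T ×ˢ Ioc 0 1))
    (hlaw : ∀ t ∈ Icc 0 T, ∀ m ∈ Ioc (0 : ℝ) 1, -derivWithin (fun s => u s m) (Icc 0 T) t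
      - derivWithin (fun s => u t (m + 2 * s)) (Ici 0) 0
        * charVal (T - t) (charFoot (T - t) m) * ((1 - m) / 2) = 0)
    (hterm : ∀ m ∈ Ioc (0 : ℝ) 1, u T m = -m) {s m : ℝ} (hs : s ∈ Icc 0 T)
    (hm : m ∈ Ioc (0 : ℝ) 1) : u (T - s) m = -charFoot s m := by
  have hdiff : DifferentiableOn ℝ (fun p : ℝ × ℝ => u (T - p.1) p.2) (Icc 0 T ×ˢ Ioc 0 1) :=
    (hu.differentiableOn one_ne_zero).comp (f := fun p : ℝ × ℝ => (T - p.1, p.2)) (by fun_prop)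
      fun _ hp => ⟨sub_mem_Icc_zero hp.1, hp.2⟩
  set x₀ := charFoot s m
  have hx₀ : x₀ ∈ Ioc (0 : ℝ) 1 := charFoot_mem hm
  have hx := mapsTo_charPos_charFoot (t := s) hm
  have hmaps : MapsTo (fun r => (r, charPos r x₀)) (Icc 0 s) (Icc 0 T ×ˢ Ioc 0 1) :=
    fun r hr => ⟨⟨hr.1, hr.2.trans hs.2⟩, hx hr⟩
  have hderiv : ∀ r ∈ Icc 0 s,
      HasDerivWithinAt (fun r => u (T - r) (charPos r x₀)) 0 (Icc 0 s) r := fun r hr => by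
    have hL := (hdiff _ (hmaps hr)).hasFDerivWithinAt
    refine (hasDerivWithinAt_along_curve (f := fun r => u (T - r)) hL
      (hasDerivAt_charPos_time_charVal hr.1 hx₀.1.le).hasDerivWithinAt hmaps).congr_deriv ?_
    have hpde := hlaw (T - r) (sub_mem_Icc_zero (hmaps hr).1) _ (hmaps hr).2
    rw [sub_sub_cancel, charFoot_charPos hr.1 hx₀ (hx hr).1] at hpde
    linear_combination partials_eq_of_transport hT (hmaps hr).1 (hmaps hr).2 hL hpde
  have hconst := constant_of_has_deriv_right_zero
    (fun r hr => (hderiv r hr).continuousWithinAt)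
    (fun r hr => (hderiv r (Ico_subset_Icc_self hr)).mono_of_mem_nhdsWithin
      (Icc_mem_nhdsGE_of_mem hr)) s (right_mem_Icc.2 hs.1)
  rwa [charPos_charFoot hm, charPos_zero_left, sub_zero, hterm _ hx₀] at hconst

end Transport

/-! ### The entropy solution -/

lemma le_one_of_charPos_le_one {t x : ℝ} (ht : 0 ≤ t) (h : charPos t x ≤ 1) : x ≤ 1 := by
  by_contra! hlt
  have : 0 < x := zero_lt_one.trans hlt
  have : 0 < (x - 1) * (1 + x * t) ^ 2 := mul_pos (sub_pos.2 hlt) (by positivity)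
  unfold charPos at h
  linarith

lemma exists_contDiffAt_charPos_eq {t x : ℝ} (hslope : charSlope t x ≠ 0) :
    ∃ φ : ℝ × ℝ → ℝ, ContDiffAt ℝ 1 φ (t, charPos t x) ∧ φ (t, charPos t x) = x ∧
      ∀ᶠ p in 𝓝 (t, charPos t x), charPos p.1 (φ p) = p.2 := by
  let F : (ℝ × ℝ) × ℝ → ℝ := fun q => charPos q.1.1 q.2 - q.1.2
  have hF : ContDiff ℝ 1 F := by
    simp only [F, charPos]
    fun_prop
  set q : (ℝ × ℝ) × ℝ := ((t, charPos t x), x)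
  have hpartial : fderiv ℝ F q (0, 1) = charSlope t x :=
    ((hF.differentiable one_ne_zero q).hasFDerivAt.comp_hasDerivAt x
      ((hasDerivAt_const x (t, charPos t x)).prodMk (hasDerivAt_id x))).unique
      ((hasDerivAt_charPos t x).sub_const (charPos t x))
  have hinv : (fderiv ℝ F q ∘SL ContinuousLinearMap.inr ℝ (ℝ × ℝ) ℝ).IsInvertible := by
    refine ⟨ContinuousLinearEquiv.smulLeft (Units.mk0 (charSlope t x) hslope), ?_⟩
    ext
    simp [Units.smul_def, hpartial]
  have hFq : ContDiffAt ℝ 1 F q := hF.contDiffAt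
  refine ⟨hFq.implicitFunction one_ne_zero hinv, hFq.contDiffAt_implicitFunction one_ne_zero hinv,
    hFq.implicitFunction_apply_self one_ne_zero hinv, ?_⟩
  filter_upwards [hFq.eventually_apply_implicitFunction one_ne_zero hinv] with p hp
  exact sub_eq_zero.1 (hp.trans (sub_self _))

lemma contDiffOn_charFoot :
    ContDiffOn ℝ 1 (fun p : ℝ × ℝ => charFoot p.1 p.2) (Ici 0 ×ˢ Ioc 0 1) := by
  rintro ⟨t, m⟩ ⟨ht : 0 ≤ t, hm : m ∈ Ioc 0 1⟩
  obtain ⟨φ, hφ, hφ_self, hφ_eq⟩ :=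
    exists_contDiffAt_charPos_eq (charSlope_charFoot_pos ht hm).ne'
  rw [charPos_charFoot hm] at hφ hφ_self hφ_eq
  have hpos : ∀ᶠ p in 𝓝 (t, m), 0 < φ p :=
    hφ.continuousAt (Ioi_mem_nhds (hφ_self ▸ (charFoot_mem hm).1))
  refine hφ.contDiffWithinAt.congr_of_eventuallyEq ?_ hφ_self.symm
  filter_upwards [mem_nhdsWithin_of_mem_nhds hφ_eq, mem_nhdsWithin_of_mem_nhds hpos,
    self_mem_nhdsWithin] with p heq hpos ⟨hp0, hp⟩
  rw [← heq] at hp ⊢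
  exact charFoot_charPos hp0 ⟨hpos, le_one_of_charPos_le_one hp0 hp.2⟩ hp.1

lemma hasDerivAt_charVal {t x : ℝ} (ht : 0 ≤ t) (hx : 0 ≤ x) :
    HasDerivAt (charVal t) (2 / (1 + x * t) ^ 2) x := by
  have hne : 1 + x * t ≠ 0 := by positivity
  have hfactor : HasDerivAt (fun x : ℝ => 1 + x * t) t x := by
    simpa using ((hasDerivAt_id x).mul_const t).const_add 1
  refine (((hasDerivAt_id x).const_mul 2).div hfactor hne).congr_deriv ?_
  simp only [id, mul_one]
  field_simp
  ring

lemma hasDerivWithinAt_charVal_curve {t x' : ℝ} {x : ℝ → ℝ} {S : Set ℝ} (ht : 0 ≤ t)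
    (hxt : 0 ≤ x t) (hx : HasDerivWithinAt x x' S t) :
    HasDerivWithinAt (fun s => charVal s (x s))
      (2 / (1 + x t * t) ^ 2 * x' - charVal t (x t) ^ 2 / 2) S t := by
  have hne : 1 + x t * t ≠ 0 := by positivity
  refine ((hx.const_mul 2).div ((hx.mul (hasDerivWithinAt_id t S)).const_add 1)
    (by simpa using hne)).congr_deriv ?_
  simp only [id, Pi.mul_apply]
  unfold charVal
  field_simp
  ring

/-- The entropy solution to the right of the shock. -/
def valRight (t m : ℝ) : ℝ := charVal t (charFoot t m)

section ValRight

variable {t m : ℝ}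

lemma valRight_nonneg (ht : 0 ≤ t) (hm : m ∈ Ioc (0 : ℝ) 1) : 0 ≤ valRight t m :=
  charVal_nonneg ht (charFoot_mem hm).1.le

lemma contDiffOn_valRight :
    ContDiffOn ℝ 1 (fun p : ℝ × ℝ => valRight p.1 p.2) (Ici 0 ×ˢ Ioc 0 1) := by
  refine (contDiffOn_const.mul contDiffOn_charFoot).div
    (contDiffOn_const.add (contDiffOn_charFoot.mul contDiff_fst.contDiffOn)) ?_
  rintro ⟨t, m⟩ ⟨ht, hm⟩
  have : 0 ≤ charFoot t m * t := mul_nonneg (charFoot_mem hm).1.le ht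
  exact (by positivity : 1 + charFoot t m * t ≠ 0)

lemma hasDerivWithinAt_charFoot (ht : 0 ≤ t) (hm : m ∈ Ioc (0 : ℝ) 1) :
    HasDerivWithinAt (charFoot t) (charSlope t (charFoot t m))⁻¹ (Ioc 0 1) m := by
  have hdiff : HasDerivWithinAt (charFoot t) (derivWithin (charFoot t) (Ioc 0 1) m) (Ioc 0 1) m :=
    (hasDerivWithinAt_snd (contDiffOn_charFoot.differentiableOn one_ne_zero (t, m)
      ⟨ht, hm⟩).hasFDerivWithinAt ht).differentiableWithinAt.hasDerivWithinAt
  have hid : HasDerivWithinAt (charPos t ∘ charFoot t) 1 (Ioc 0 1) m :=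
    (hasDerivWithinAt_id m _).congr (fun n hn => charPos_charFoot hn) (charPos_charFoot hm)
  refine hdiff.congr_deriv (eq_inv_of_mul_eq_one_right ?_)
  exact (uniqueDiffOn_Ioc 0 1 m hm).eq_deriv _
    ((hasDerivAt_charPos t (charFoot t m)).comp_hasDerivWithinAt m hdiff) hid

lemma hasDerivWithinAt_charFoot_time (ht : 0 ≤ t) (hm : m ∈ Ioc (0 : ℝ) 1) :
    HasDerivWithinAt (fun s => charFoot s m)
      ((1 - m) * valRight t m * (charSlope t (charFoot t m))⁻¹) (Ici 0) t := by
  set x := charFoot t m with hx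
  set d := derivWithin (fun s => charFoot s m) (Ici 0) t
  have hdiff : HasDerivWithinAt (fun s => charFoot s m) d (Ici 0) t :=
    (hasDerivWithinAt_fst (contDiffOn_charFoot.differentiableOn one_ne_zero (t, m)
      ⟨ht, hm⟩).hasFDerivWithinAt hm).differentiableWithinAt.hasDerivWithinAt
  have hchain : HasDerivWithinAt (fun s => charPos s (charFoot s m))
      (charSlope t x * d - 2 * x * (1 - x) * (1 + x * t)) (Ici 0) t := by
    refine (((hdiff.const_sub 1).mul
      (((hdiff.mul (hasDerivWithinAt_id t _)).const_add 1).pow 2)).const_sub 1).congr_deriv ?_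
    simp [charSlope, ← hx]
    ring
  have hconst : HasDerivWithinAt (fun s => charPos s (charFoot s m)) 0 (Ici 0) t :=
    (hasDerivWithinAt_const t _ m).congr (fun _ _ => charPos_charFoot hm) (charPos_charFoot hm)
  have hvel : (1 - m) * valRight t m = 2 * x * (1 - x) * (1 + x * t) := by
    have hvel_at : -((1 - charPos t x) * charVal t x) = -(2 * x * (1 - x) * (1 + x * t)) :=
      (hasDerivAt_charPos_time_charVal ht (charFoot_mem hm).1.le).unique
        (hasDerivAt_charPos_time t x)
    rw [charPos_charFoot hm] at hvel_at
    exact neg_injective hvel_at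
  refine hdiff.congr_deriv ((eq_mul_inv_iff_mul_eq₀ (charSlope_charFoot_pos ht hm).ne').2 ?_)
  linear_combination (uniqueDiffOn_Ici 0 t ht).eq_deriv _ hchain hconst - hvel

lemma exists_hasDerivWithinAt_valRight (ht : 0 ≤ t) (hm : m ∈ Ioc (0 : ℝ) 1) :
    ∃ d, HasDerivWithinAt (fun s => valRight s m)
        ((1 - m) * valRight t m * d - valRight t m ^ 2 / 2) (Ici 0) t ∧
      HasDerivWithinAt (valRight t) d (Ioc 0 1) m := by
  have hfoot := (charFoot_mem (t := t) hm).1.le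
  refine ⟨2 / (1 + charFoot t m * t) ^ 2 * (charSlope t (charFoot t m))⁻¹, ?_, ?_⟩
  · refine (hasDerivWithinAt_charVal_curve ht hfoot
      (hasDerivWithinAt_charFoot_time ht hm)).congr_deriv ?_
    unfold valRight
    ring
  · exact (hasDerivAt_charVal ht hfoot).comp_hasDerivWithinAt m (hasDerivWithinAt_charFoot ht hm)

lemma valRight_zero (hm : m ∈ Ioc (0 : ℝ) 1) : valRight 0 m = 2 * m := by
  simp [valRight, charVal, charFoot_zero_left hm]

lemma valRight_mono {n : ℝ} (ht : 0 ≤ t) (hm : m ∈ Ioc (0 : ℝ) 1) (hn : n ∈ Ioc (0 : ℝ) 1)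
    (hmn : m ≤ n) : valRight t m ≤ valRight t n :=
  sub_nonneg.1 (charVal_sub_mem ht (charFoot_mem hm).1.le (charFoot_mono ht hm hn hmn)).1

end ValRight

/-- The function equal to `f t m` for `m > 0` and to `g t (-m)` for `m < 0`: the entropy solution
and the solution of the master equation are given by one formula on each side of the shock. -/
def glue (f g : ℝ → ℝ → ℝ) (t m : ℝ) : ℝ := if 0 < m then f t m else if m < 0 then g t (-m) else 0

section Glue

variable {f g : ℝ → ℝ → ℝ}

lemma glue_of_pos {t m : ℝ} (hm : 0 < m) : glue f g t m = f t m := if_pos hm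

lemma glue_neg (f g : ℝ → ℝ → ℝ) (t m : ℝ) : glue f g t (-m) = glue g f t m := by
  unfold glue
  rcases lt_trichotomy m 0 with hm | rfl | hm
  · simp [hm, hm.not_gt]
  · simp
  · simp [hm, hm.not_gt]

lemma glue_zero (f g : ℝ → ℝ → ℝ) (t : ℝ) : glue f g t 0 = 0 := by simp [glue]

lemma contDiffWithinAt_glue_of_pos {T t m : ℝ}
    (hf : ContDiffOn ℝ 1 (fun p : ℝ × ℝ => f p.1 p.2) (Ici 0 ×ˢ Ioc 0 1)) (ht : t ∈ Icc 0 T)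
    (hm : m ∈ Ioc (0 : ℝ) 1) : ContDiffWithinAt ℝ 1 (fun p : ℝ × ℝ => glue f g p.1 p.2)
      (Icc 0 T ×ˢ (Icc (-1) 1 \ {0})) (t, m) := by
  have hpos : ∀ᶠ p : ℝ × ℝ in 𝓝 (t, m), 0 < p.2 := continuousAt_snd (Ioi_mem_nhds hm.1)
  refine ((hf (t, m) ⟨ht.1, hm⟩).mono_of_mem_nhdsWithin ?_).congr_of_eventuallyEq
    ?_ (glue_of_pos hm.1)
  · filter_upwards [mem_nhdsWithin_of_mem_nhds hpos, self_mem_nhdsWithin] with p hp0 hp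
    exact ⟨hp.1.1, hp0, hp.2.1.2⟩
  · filter_upwards [mem_nhdsWithin_of_mem_nhds hpos] with p hp
    exact glue_of_pos hp

lemma contDiffOn_glue {T : ℝ}
    (hf : ContDiffOn ℝ 1 (fun p : ℝ × ℝ => f p.1 p.2) (Ici 0 ×ˢ Ioc 0 1))
    (hg : ContDiffOn ℝ 1 (fun p : ℝ × ℝ => g p.1 p.2) (Ici 0 ×ˢ Ioc 0 1)) :
    ContDiffOn ℝ 1 (fun p : ℝ × ℝ => glue f g p.1 p.2) (Icc 0 T ×ˢ (Icc (-1) 1 \ {0})) := by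
  rintro ⟨t, m⟩ ⟨ht : t ∈ Icc 0 T, hm : m ∈ Icc (-1) 1, hm0 : m ≠ 0⟩
  rcases hm0.lt_or_gt with hneg | hpos
  · have hreflected := (contDiffWithinAt_glue_of_pos (g := f) hg ht
      (m := -m) ⟨by linarith, by linarith [hm.1]⟩).comp (t, m)
      (f := fun p : ℝ × ℝ => (p.1, -p.2)) (s := Icc 0 T ×ˢ (Icc (-1) 1 \ {0})) (by fun_prop)
      fun p hp => ⟨hp.1, ⟨by linarith [hp.2.1.2], by linarith [hp.2.1.1]⟩, by simpa using hp.2.2⟩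
    simpa only [Function.comp_def, glue_neg] using hreflected
  · exact contDiffWithinAt_glue_of_pos hf ht ⟨hpos, hm.2⟩

end Glue

/-- The entropy solution; it is odd in `m`. -/
def entropySol : ℝ → ℝ → ℝ := glue valRight fun t m => -valRight t m

lemma entropySol_of_pos {t m : ℝ} (hm : 0 < m) : entropySol t m = valRight t m := glue_of_pos hm

lemma entropySol_neg (t m : ℝ) : entropySol t (-m) = -entropySol t m := by
  unfold entropySol
  rw [glue_neg]
  unfold glue
  split_ifs <;> simp

lemma flux_neg_neg (m z : ℝ) : flux (-m) (-z) = flux m z := by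
  unfold flux
  rw [abs_neg]
  ring

lemma conservationLaw_reflect (T : ℝ) (Z : ℝ → ℝ → ℝ) (t m : ℝ) :
    derivWithin (fun s => -Z s (-m)) (Icc 0 T) t
        + derivWithin (fun y => flux y (-Z t (-y))) (Icc (-1) 1) m
      = -(derivWithin (fun s => Z s (-m)) (Icc 0 T) t
        + derivWithin (fun y => flux y (Z t y)) (Icc (-1) 1) (-m)) := by
  have hflux : (fun y => flux y (-Z t (-y))) = fun y => (fun y => flux y (Z t y)) (-y) := by
    funext y
    simpa only [neg_neg] using flux_neg_neg (-y) (Z t (-y))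
  have hneg : -Icc (-1 : ℝ) 1 = Icc (-1) 1 := by simp
  have htime : derivWithin (fun s => -Z s (-m)) (Icc 0 T) t
      = -derivWithin (fun s => Z s (-m)) (Icc 0 T) t := derivWithin.fun_neg
  rw [hflux, derivWithin_comp_neg (fun y => flux y (Z t y)), hneg, htime, neg_add]

lemma entropySol_conservationLaw_of_pos {T t m : ℝ} (hT : 0 < T) (ht : t ∈ Icc 0 T)
    (hm : m ∈ Ioc (0 : ℝ) 1) :
    derivWithin (fun s => entropySol s m) (Icc 0 T) t
      + derivWithin (fun y => flux y (entropySol t y)) (Icc (-1) 1) m = 0 := by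
  obtain ⟨d, htime, hspace⟩ := exists_hasDerivWithinAt_valRight ht.1 hm
  have hspace' : HasDerivWithinAt (entropySol t) d (Icc (-1) 1) m :=
    (hspace.congr (fun n hn => entropySol_of_pos hn.1)
      (entropySol_of_pos hm.1)).mono_of_mem_nhdsWithin (Ioc_mem_nhdsWithin_Icc hm)
  simp only [entropySol_of_pos hm.1]
  rw [(htime.mono Icc_subset_Ici_self).derivWithin (uniqueDiffOn_Icc hT t ht),
    (hasDerivWithinAt_flux hspace').derivWithin
      (uniqueDiffOn_Icc (by norm_num) m ⟨by linarith [hm.1], hm.2⟩),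
    entropySol_of_pos hm.1, abs_of_nonneg (valRight_nonneg ht.1 hm)]
  ring

lemma entropySol_conservationLaw {T t m : ℝ} (hT : 0 < T) (ht : t ∈ Icc 0 T)
    (hm : m ∈ Icc (-1 : ℝ) 1) (hm0 : m ≠ 0) :
    derivWithin (fun s => entropySol s m) (Icc 0 T) t
      + derivWithin (fun y => flux y (entropySol t y)) (Icc (-1) 1) m = 0 := by
  rcases hm0.lt_or_gt with hneg | hpos
  · have hreflect := conservationLaw_reflect T entropySol t m
    rw [entropySol_conservationLaw_of_pos hT ht ⟨neg_pos.2 hneg, by linarith [hm.1]⟩] at hreflect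
    simpa only [entropySol_neg, neg_neg, neg_zero] using hreflect
  · exact entropySol_conservationLaw_of_pos hT ht ⟨hpos, hm.2⟩

lemma entropySol_zero {m : ℝ} (hm : m ∈ Icc (-1 : ℝ) 1) : entropySol 0 m = 2 * m := by
  rcases lt_trichotomy m 0 with hneg | rfl | hpos
  · have hodd := entropySol_neg 0 m
    rw [entropySol_of_pos (neg_pos.2 hneg), valRight_zero ⟨by linarith, by linarith [hm.1]⟩] at hodd
    linarith
  · simp [entropySol, glue_zero]
  · rw [entropySol_of_pos hpos, valRight_zero ⟨hpos, hm.2⟩]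

lemma exists_tendsto_entropySol_nhdsGT {t : ℝ} (ht : 0 ≤ t) :
    ∃ z, 0 ≤ z ∧ Tendsto (entropySol t) (𝓝[>] 0) (𝓝 z) := by
  have hmono : MonotoneOn (entropySol t) (Ioo 0 1) := fun m hm n hn hmn => by
    rw [entropySol_of_pos hm.1, entropySol_of_pos hn.1]
    exact valRight_mono ht (Ioo_subset_Ioc_self hm) (Ioo_subset_Ioc_self hn) hmn
  have hnonneg : ∀ y ∈ entropySol t '' Ioo 0 1, 0 ≤ y := by
    rintro _ ⟨m, hm, rfl⟩
    rw [entropySol_of_pos hm.1]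
    exact valRight_nonneg ht (Ioo_subset_Ioc_self hm)
  exact ⟨_, Real.sInf_nonneg hnonneg,
    hmono.tendsto_nhdsWithin_Ioo_right (nonempty_Ioo.2 zero_lt_one) ⟨0, hnonneg⟩⟩

lemma flux_zero_slope {c z : ℝ} (h : c ≠ z) : (flux 0 c - flux 0 z) / (c - z) = -(c + z) / 2 := by
  have : c - z ≠ 0 := sub_ne_zero.2 h
  unfold flux
  field_simp
  ring

theorem isEntropySolution_entropySol {T : ℝ} (hT : 0 < T) :
    IsEntropySolution flux (fun m => 2 * m) T (fun _ => 0) entropySol where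
  curve := contDiffOn_const
  smooth := (contDiffOn_glue contDiffOn_valRight contDiffOn_valRight.neg).mono
    fun _ hp => ⟨hp.1, hp.2.1, hp.2.2⟩
  equation _ ht _ hm hm0 := entropySol_conservationLaw hT ht hm hm0
  initial _ hm := entropySol_zero hm
  shock t ht := by
    obtain ⟨z, hz, hright⟩ := exists_tendsto_entropySol_nhdsGT ht.1
    have hleft : Tendsto (entropySol t) (𝓝[<] 0) (𝓝 (-z)) := by
      have hneg : Tendsto (fun m : ℝ => -m) (𝓝[<] 0) (𝓝[>] 0) := by
        simpa using tendsto_neg_nhdsLT (a := (0 : ℝ))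
      refine (hright.comp hneg).neg.congr fun m => ?_
      simp only [Function.comp_apply, entropySol_neg, neg_neg]
    refine ⟨-z, z, hleft, hright, fun _ => by simp [flux], fun c hc => ?_⟩
    rw [min_eq_left (neg_le_self hz), max_eq_right (neg_le_self hz)] at hc
    simp only [derivWithin_fun_const, Pi.zero_apply]
    rw [flux_zero_slope hc.2.ne, flux_zero_slope hc.1.ne']
    exact ⟨by linarith [hc.1], by linarith [hc.2]⟩

lemma IsEntropySolution.eq_valRight {T : ℝ} (hT : 0 < T) {Z : ℝ → ℝ → ℝ}
    (hZ : IsEntropySolution flux (fun m => 2 * m) T (fun _ => 0) Z) {t m : ℝ} (ht : t ∈ Icc 0 T)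
    (hm : m ∈ Ioc (0 : ℝ) 1) : Z t m = valRight t m :=
  eq_charVal_of_conservationLaw hT
    (hZ.smooth.mono fun _ hp => ⟨hp.1, ⟨by linarith [hp.2.1], hp.2.2⟩, hp.2.1.ne'⟩)
    (fun t ht m hm => hZ.equation t ht m ⟨by linarith [hm.1], hm.2⟩ hm.1.ne')
    (fun m hm => hZ.initial m ⟨by linarith [hm.1], hm.2⟩) ht hm

lemma IsEntropySolution.neg_eq_valRight {T : ℝ} (hT : 0 < T) {Z : ℝ → ℝ → ℝ}
    (hZ : IsEntropySolution flux (fun m => 2 * m) T (fun _ => 0) Z) {t m : ℝ} (ht : t ∈ Icc 0 T)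
    (hm : m ∈ Ioc (0 : ℝ) 1) : -Z t (-m) = valRight t m := by
  have hmem : ∀ {n : ℝ}, n ∈ Ioc (0 : ℝ) 1 → -n ∈ Icc (-1 : ℝ) 1 := fun hn =>
    ⟨by linarith [hn.2], by linarith [hn.1]⟩
  refine eq_charVal_of_conservationLaw hT (Z := fun t m => -Z t (-m)) ?_ (fun t ht m hm => ?_)
    (fun m hm => ?_) ht hm
  · exact (hZ.smooth.comp (f := fun p : ℝ × ℝ => (p.1, -p.2)) (by fun_prop)
      fun _ hp => ⟨hp.1, hmem hp.2, (neg_neg_of_pos hp.2.1).ne⟩).neg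
  · rw [conservationLaw_reflect, hZ.equation t ht (-m) (hmem hm) (neg_neg_of_pos hm.1).ne, neg_zero]
  · simp only [hZ.initial (-m) (hmem hm)]
    ring

/-! ### The solution of the master equation -/

lemma stateVal_one : stateVal 1 = 1 := by simp [stateVal]

lemma stateVal_neg (x : ℤˣ) : stateVal (-x) = -stateVal x := by simp [stateVal]

section MasterEquation

variable (T : ℝ) (U : ℝ → ℤˣ → ℝ → ℝ) (t m : ℝ) (x : ℤˣ)

lemma stateDiff_neg : stateDiff U t (-x) m = -stateDiff U t x m := by simp [stateDiff]

lemma measureDeriv_neg_one :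
    measureDeriv U t x m (-1) = derivWithin (fun s => U t x (m + 2 * s)) (Ici 0) 0 := by
  simp [measureDeriv, stateVal]

/-- The left-hand side of the master equation on the time interval `[0, T]`. -/
def masterResidual (T : ℝ) (U : ℝ → ℤˣ → ℝ → ℝ) (t : ℝ) (x : ℤˣ) (m : ℝ) : ℝ :=
  - derivWithin (fun s => U s x m) (Icc 0 T) t + (stateDiff U t x m)⁻ ^ 2 / 2
    - measureDeriv U t x m 1 * (stateDiff U t 1 m)⁻ * ((1 + m) / 2)
    - measureDeriv U t x m (-1) * (stateDiff U t (-1) m)⁻ * ((1 - m) / 2)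

variable {T U t m x}

lemma masterResidual_of_nonneg (h : 0 ≤ stateDiff U t 1 m) :
    masterResidual T U t x m = -derivWithin (fun s => U s x m) (Icc 0 T) t
      + (stateDiff U t x m)⁻ ^ 2 / 2
      - derivWithin (fun s => U t x (m + 2 * s)) (Ici 0) 0 * stateDiff U t 1 m * ((1 - m) / 2) := by
  rw [masterResidual, stateDiff_neg U t m 1, negPart_neg, posPart_eq_self.2 h, negPart_eq_zero.2 h,
    measureDeriv_neg_one]
  ring

/-- The values seen after exchanging the two states: both the conservation law and the master
equation are invariant under this exchange. -/
def reflect (U : ℝ → ℤˣ → ℝ → ℝ) (t : ℝ) (x : ℤˣ) (m : ℝ) : ℝ := U t (-x) (-m)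

lemma stateDiff_reflect : stateDiff (reflect U) t x m = stateDiff U t (-x) (-m) := rfl

lemma measureDeriv_reflect (y : ℤˣ) :
    measureDeriv (reflect U) t x m y = measureDeriv U t (-x) (-m) (-y) := by
  have hpert : ∀ s, -(m - 2 * stateVal y * s) = -m - 2 * stateVal (-y) * s := fun s => by
    rw [stateVal_neg]
    ring
  simp only [measureDeriv, reflect, hpert]

lemma masterResidual_reflect :
    masterResidual T (reflect U) t x m = masterResidual T U t (-x) (-m) := by
  simp only [masterResidual, stateDiff_reflect, measureDeriv_reflect, reflect, neg_neg]
  ring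

lemma IsMasterSolution.reflect {Z : ℝ → ℝ → ℝ} (hU : IsMasterSolution T Z U) :
    IsMasterSolution T (fun t m => -Z t (-m)) (reflect U) where
  smooth x := (hU.smooth (-x)).comp (f := fun p : ℝ × ℝ => (p.1, -p.2)) (by fun_prop)
    fun p hp => ⟨hp.1, ⟨by linarith [hp.2.1.2], by linarith [hp.2.1.1]⟩, by simpa using hp.2.2⟩
  equation t ht m hm hm0 x := masterResidual_reflect.trans
    (hU.equation t ht (-m) ⟨by linarith [hm.2], by linarith [hm.1]⟩ (neg_ne_zero.2 hm0) (-x))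
  terminal m hm x := by
    simp [TwoStateMFG.reflect, stateVal_neg,
      hU.terminal (-m) ⟨by linarith [hm.2], by linarith [hm.1]⟩]
  increment t ht m hm := by
    rw [stateDiff_reflect, stateDiff_neg,
      hU.increment t ht (-m) ⟨by linarith [hm.2], by linarith [hm.1]⟩]

lemma IsMasterSolution.eq_neg_charFoot (hT : 0 < T) {Z : ℝ → ℝ → ℝ} (hU : IsMasterSolution T Z U)
    (hZ : ∀ t ∈ Icc 0 T, ∀ m ∈ Ioc (0 : ℝ) 1, Z t m = valRight t m) (ht : t ∈ Icc 0 T)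
    (hm : m ∈ Ioc (0 : ℝ) 1) : U (T - t) 1 m = -charFoot t m := by
  have hmem : ∀ {n : ℝ}, n ∈ Ioc (0 : ℝ) 1 → n ∈ Icc (-1 : ℝ) 1 := fun hn =>
    ⟨by linarith [hn.1], hn.2⟩
  refine eq_neg_charFoot_of_transport hT (u := fun t m => U t 1 m)
    ((hU.smooth 1).mono fun _ hp => ⟨hp.1, hmem hp.2, hp.2.1.ne'⟩) (fun t ht m hm => ?_)
    (fun m hm => ?_) ht hm
  · have hdiff : stateDiff U t 1 m = valRight (T - t) m := by
      rw [hU.increment t ht m (hmem hm), hZ _ (sub_mem_Icc_zero ht) m hm]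
    have hnonneg : 0 ≤ stateDiff U t 1 m :=
      hdiff ▸ valRight_nonneg (sub_mem_Icc_zero ht).1 hm
    have hres : masterResidual T U t 1 m = 0 := hU.equation t ht m (hmem hm) hm.1.ne' 1
    rw [masterResidual_of_nonneg hnonneg, negPart_eq_zero.2 hnonneg, hdiff, valRight] at hres
    linear_combination hres
  · simpa [stateVal_one] using hU.terminal m (hmem hm) 1

variable {Z : ℝ → ℝ → ℝ}

lemma IsMasterSolution.eq_neg_charFoot_of_entropy (hT : 0 < T)
    (hZ : IsEntropySolution flux (fun m => 2 * m) T (fun _ => 0) Z) (hU : IsMasterSolution T Z U)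
    (ht : t ∈ Icc 0 T) (hm : m ∈ Ioc (0 : ℝ) 1) : U (T - t) 1 m = -charFoot t m :=
  hU.eq_neg_charFoot hT (fun _ ht _ hm => hZ.eq_valRight hT ht hm) ht hm

lemma IsMasterSolution.neg_eq_charCost_of_entropy (hT : 0 < T)
    (hZ : IsEntropySolution flux (fun m => 2 * m) T (fun _ => 0) Z) (hU : IsMasterSolution T Z U)
    (ht : t ∈ Icc 0 T) (hm : m ∈ Ioc (0 : ℝ) 1) :
    U (T - t) 1 (-m) = charCost t (charFoot t m) := by
  have hother : U (T - t) (-1) (-m) = -charFoot t m :=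
    hU.reflect.eq_neg_charFoot hT (fun _ ht _ hm => hZ.neg_eq_valRight hT ht hm) ht hm
  have hdiff : U (T - t) (-1) (-m) - U (T - t) 1 (-m) = Z t (-m) := by
    simpa only [stateDiff, sub_sub_cancel] using
      hU.increment (T - t) (sub_mem_Icc_zero ht) (-m) ⟨by linarith [hm.2], by linarith [hm.1]⟩
  have hval : -Z t (-m) = charVal t (charFoot t m) := hZ.neg_eq_valRight hT ht hm
  unfold charCost
  linarith

end MasterEquation

/-- The value, in reversed time, of a player in state `x` when the mean `m` is positive. -/
def stateCost (x : ℤˣ) (s m : ℝ) : ℝ :=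
  if x = 1 then -charFoot s m else charCost s (charFoot s m)

section StateCost

variable {s m : ℝ}

lemma stateCost_one : stateCost 1 s m = -charFoot s m := if_pos rfl

lemma stateCost_neg_one : stateCost (-1) s m = -charFoot s m + valRight s m := if_neg (by decide)

lemma contDiffOn_stateCost (x : ℤˣ) :
    ContDiffOn ℝ 1 (fun p : ℝ × ℝ => stateCost x p.1 p.2) (Ici 0 ×ˢ Ioc 0 1) := by
  rcases Int.units_eq_one_or x with rfl | rfl
  · simpa only [stateCost_one] using contDiffOn_charFoot.neg
  · simpa only [stateCost_neg_one] using contDiffOn_charFoot.neg.add contDiffOn_valRight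

lemma exists_hasDerivWithinAt_stateCost (x : ℤˣ) (hs : 0 ≤ s) (hm : m ∈ Ioc (0 : ℝ) 1) :
    ∃ d, HasDerivWithinAt (fun r => stateCost x r m) ((1 - m) * valRight s m * d
        - (stateCost (-x) s m - stateCost x s m)⁻ ^ 2 / 2) (Ici 0) s ∧
      HasDerivWithinAt (stateCost x s) d (Ioc 0 1) m := by
  have htime := (hasDerivWithinAt_charFoot_time hs hm).neg
  have hspace := (hasDerivWithinAt_charFoot hs hm).neg
  have hnonneg := valRight_nonneg hs hm
  rcases Int.units_eq_one_or x with rfl | rfl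
  · refine ⟨_, (htime.congr_deriv ?_).congr (fun _ _ => stateCost_one) stateCost_one,
      hspace.congr (fun _ _ => stateCost_one) stateCost_one⟩
    rw [stateCost_one, stateCost_neg_one, negPart_eq_zero.2 (by simpa using hnonneg)]
    ring
  · obtain ⟨d, hval_time, hval_space⟩ := exists_hasDerivWithinAt_valRight hs hm
    refine ⟨_, ((htime.add hval_time).congr_deriv ?_).congr (fun _ _ => stateCost_neg_one)
      stateCost_neg_one, (hspace.add hval_space).congr (fun _ _ => stateCost_neg_one)
      stateCost_neg_one⟩
    have hdiff : stateCost 1 s m - stateCost (-1) s m = -valRight s m := by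
      rw [stateCost_one, stateCost_neg_one]
      ring
    rw [neg_neg, hdiff, negPart_neg, posPart_eq_self.2 hnonneg]
    ring

lemma stateCost_zero_left (x : ℤˣ) (hm : m ∈ Ioc (0 : ℝ) 1) :
    stateCost x 0 m = -m * stateVal x := by
  rcases Int.units_eq_one_or x with rfl | rfl
  · simp [stateCost_one, stateVal_one, charFoot_zero_left hm]
  · rw [stateCost_neg_one, stateVal_neg, stateVal_one, charFoot_zero_left hm, valRight_zero hm]
    ring

end StateCost

/-- The solution of the master equation that corresponds to `entropySol`. -/
def masterSol (T t : ℝ) (x : ℤˣ) (m : ℝ) : ℝ := glue (stateCost x) (stateCost (-x)) (T - t) m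

section MasterSol

variable {T t m : ℝ}

lemma masterSol_of_pos {x : ℤˣ} (hm : 0 < m) : masterSol T t x m = stateCost x (T - t) m :=
  glue_of_pos hm

lemma reflect_masterSol (T : ℝ) : reflect (masterSol T) = masterSol T := by
  funext t x m
  simp only [reflect, masterSol, glue_neg, neg_neg]

lemma stateDiff_masterSol_of_pos {x : ℤˣ} (hm : 0 < m) :
    stateDiff (masterSol T) t x m = stateCost (-x) (T - t) m - stateCost x (T - t) m := by
  simp only [stateDiff, masterSol_of_pos hm]

lemma stateDiff_masterSol (T t m : ℝ) :
    stateDiff (masterSol T) t 1 m = entropySol (T - t) m := by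
  simp only [stateDiff, masterSol, entropySol, glue, neg_neg, stateCost_one, stateCost_neg_one]
  split_ifs <;> ring

lemma masterResidual_masterSol_of_pos (hT : 0 < T) (ht : t ∈ Icc 0 T) (hm : m ∈ Ioc (0 : ℝ) 1)
    (x : ℤˣ) : masterResidual T (masterSol T) t x m = 0 := by
  have hs := (sub_mem_Icc_zero ht).1
  obtain ⟨d, htime, hspace⟩ := exists_hasDerivWithinAt_stateCost x hs hm
  have htime' := (hasDerivWithinAt_comp_const_sub_Icc (htime.mono Icc_subset_Ici_self)).congr
    (fun r _ => masterSol_of_pos (T := T) (t := r) hm.1) (masterSol_of_pos hm.1)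
  have hspace' := derivWithin_comp_add_two_mul hm
    (hspace.congr (fun n hn => masterSol_of_pos (T := T) (t := t) hn.1) (masterSol_of_pos hm.1))
  have hdiff : stateDiff (masterSol T) t 1 m = valRight (T - t) m := by
    rw [stateDiff_masterSol, entropySol_of_pos hm.1]
  rw [masterResidual_of_nonneg (hdiff ▸ valRight_nonneg hs hm), hdiff,
    stateDiff_masterSol_of_pos hm.1, htime'.derivWithin (uniqueDiffOn_Icc hT t ht)]
  linear_combination -valRight (T - t) m * hspace'

lemma masterResidual_masterSol (hT : 0 < T) (ht : t ∈ Icc 0 T) (hm : m ∈ Icc (-1 : ℝ) 1)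
    (hm0 : m ≠ 0) (x : ℤˣ) : masterResidual T (masterSol T) t x m = 0 := by
  rcases hm0.lt_or_gt with hneg | hpos
  · rw [← reflect_masterSol, masterResidual_reflect]
    exact masterResidual_masterSol_of_pos hT ht ⟨neg_pos.2 hneg, by linarith [hm.1]⟩ (-x)
  · exact masterResidual_masterSol_of_pos hT ht ⟨hpos, hm.2⟩ x

lemma masterSol_terminal (hm : m ∈ Icc (-1 : ℝ) 1) (x : ℤˣ) :
    masterSol T T x m = -m * stateVal x := by
  rcases lt_trichotomy m 0 with hneg | rfl | hpos
  · rw [← reflect_masterSol, reflect, masterSol_of_pos (neg_pos.2 hneg), sub_self,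
      stateCost_zero_left _ ⟨neg_pos.2 hneg, by linarith [hm.1]⟩, stateVal_neg]
    ring
  · simp [masterSol, glue_zero]
  · rw [masterSol_of_pos hpos, sub_self, stateCost_zero_left x ⟨hpos, hm.2⟩]

theorem isMasterSolution_masterSol (hT : 0 < T) :
    IsMasterSolution T entropySol (masterSol T) where
  smooth x := (contDiffOn_glue (contDiffOn_stateCost x) (contDiffOn_stateCost (-x))).comp
    (f := fun p : ℝ × ℝ => (T - p.1, p.2)) (by fun_prop)
    fun _ hp => ⟨sub_mem_Icc_zero hp.1, hp.2⟩
  equation _ ht _ hm hm0 x := masterResidual_masterSol hT ht hm hm0 x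
  terminal _ hm x := masterSol_terminal hm x
  increment t _ m _ := stateDiff_masterSol T t m

end MasterSol

/-! ### Consistency and the error estimate -/

section Consistency

variable {s m h δ : ℝ}

lemma charFoot_sub_le {n : ℝ} (hs : 0 ≤ s) (hδ : 0 < δ) (hm : m ∈ Ioc (0 : ℝ) 1)
    (hn : n ∈ Ioc (0 : ℝ) 1) (hmn : m ≤ n) (hδm : δ ≤ m + s * charFoot s m) :
    charFoot s n - charFoot s m ≤ (n - m) / δ := by
  refine (le_div_iff₀' hδ).2 (le_trans ?_ (mul_charFoot_sub_le hs hm hn hmn))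
  exact mul_le_mul_of_nonneg_right hδm (sub_nonneg.2 (charFoot_mono hs hm hn hmn))

lemma charFoot_add_sub_mem (hs : 0 ≤ s) (hδ : 0 < δ) (hm : δ ≤ m) (hh : 0 ≤ h)
    (hmh : m + h ≤ 1) : charFoot s (m + h) - charFoot s m ∈ Icc 0 (h / δ) := by
  have hm' : m ∈ Ioc (0 : ℝ) 1 := ⟨hδ.trans_le hm, by linarith⟩
  have hmh' : m + h ∈ Ioc (0 : ℝ) 1 := ⟨by linarith [hm'.1], hmh⟩
  have hδm : δ ≤ m + s * charFoot s m :=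
    hm.trans (le_add_of_nonneg_right (mul_nonneg hs (charFoot_mem hm').1.le))
  have hle := charFoot_sub_le hs hδ hm' hmh' (by linarith) hδm
  rw [add_sub_cancel_left] at hle
  exact ⟨sub_nonneg.2 (charFoot_mono hs hm' hmh' (by linarith)), hle⟩

lemma abs_charFoot_diffQuot_sub_le (hs : 0 ≤ s) (hδ : 0 < δ) (hm : δ ≤ m) (hh : 0 < h)
    (hmh : m + h ≤ 1) :
    |(charFoot s (m + h) - charFoot s m) / h - (charSlope s (charFoot s m))⁻¹|
      ≤ (2 * s + 2 * s ^ 2) / δ ^ 3 * h := by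
  have hm' : m ∈ Ioc (0 : ℝ) 1 := ⟨hδ.trans_le hm, by linarith⟩
  have hmh' : m + h ∈ Ioc (0 : ℝ) 1 := ⟨by linarith [hm'.1], hmh⟩
  obtain ⟨hd, hdle⟩ := charFoot_add_sub_mem hs hδ hm hh.le hmh
  have htaylor := abs_charPos_sub_sub_le hs (Ioc_subset_Icc_self (charFoot_mem (t := s) hm'))
    (Ioc_subset_Icc_self (charFoot_mem (t := s) hmh'))
  rw [charPos_charFoot hm', charPos_charFoot hmh'] at htaylor
  have hσ : δ ≤ charSlope s (charFoot s m) := hm.trans (le_charSlope_charFoot hs hm')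
  set σ := charSlope s (charFoot s m)
  set d := charFoot s (m + h) - charFoot s m
  have hσ0 : 0 < σ := hδ.trans_le hσ
  have hsplit : d / h - σ⁻¹ = -(m + h - m - σ * d) / (h * σ) := by
    field_simp
    ring
  rw [hsplit, abs_div, abs_neg, abs_of_pos (mul_pos hh hσ0), div_le_iff₀ (mul_pos hh hσ0)]
  calc |m + h - m - σ * d| ≤ (2 * s + 2 * s ^ 2) * d ^ 2 := htaylor
    _ ≤ (2 * s + 2 * s ^ 2) * (h / δ) ^ 2 := by gcongr
    _ = (2 * s + 2 * s ^ 2) / δ ^ 3 * h * (h * δ) := by field_simp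
    _ ≤ (2 * s + 2 * s ^ 2) / δ ^ 3 * h * (h * σ) := by gcongr

/-- The constant in the consistency error, at time `s` and at distance `δ` from the shock, of the
limit as an approximate solution of the reduced system. -/
def consistencyConst (s δ : ℝ) : ℝ := (2 + 4 * s) / δ ^ 2 + 2 * ((2 * s + 2 * s ^ 2) / δ ^ 3)

lemma consistencyConst_nonneg (hs : 0 ≤ s) (hδ : 0 < δ) : 0 ≤ consistencyConst s δ := by
  unfold consistencyConst; positivity

lemma consistencyConst_mono {T : ℝ} (hs : 0 ≤ s) (hsT : s ≤ T) (hδ : 0 < δ) :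
    consistencyConst s δ ≤ consistencyConst T δ := by
  unfold consistencyConst
  gcongr

lemma valRight_le_two (hs : 0 ≤ s) (hm : m ∈ Ioc (0 : ℝ) 1) : valRight s m ≤ 2 := by
  have hfoot := charFoot_mem (t := s) hm
  exact (charVal_le hs hfoot.1.le).trans (by linarith [hfoot.2])

lemma abs_majority_defect_le (hs : 0 ≤ s) (hδ : 0 < δ) (hm : δ ≤ m) (hh : 0 < h)
    (hmh : m + h ≤ 1) :
    |-((1 - m) * valRight s m * (charSlope s (charFoot s m))⁻¹)
      - (1 - m) / h * valRight s (m + h) * (-charFoot s (m + h) - -charFoot s m)|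
      ≤ consistencyConst s δ * h := by
  have hm' : m ∈ Ioc (0 : ℝ) 1 := ⟨hδ.trans_le hm, by linarith⟩
  obtain ⟨hd, hdle⟩ := charFoot_add_sub_mem hs hδ hm hh.le hmh
  have htaylor := abs_charFoot_diffQuot_sub_le hs hδ hm hh hmh
  obtain ⟨hζζ', hζle⟩ : valRight s (m + h) - valRight s m ∈
      Icc 0 (2 * (charFoot s (m + h) - charFoot s m)) :=
    charVal_sub_mem hs (charFoot_mem hm').1.le (sub_nonneg.1 hd)
  have hζ := valRight_nonneg hs hm'
  have hζ2 := valRight_le_two hs hm'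
  set σ := charSlope s (charFoot s m)
  set ζ := valRight s m
  set ζ' := valRight s (m + h)
  set d := charFoot s (m + h) - charFoot s m with hd_def
  have hsplit : -((1 - m) * ζ * σ⁻¹)
      - (1 - m) / h * ζ' * (-charFoot s (m + h) - -charFoot s m)
      = (1 - m) * ((ζ' - ζ) * (d / h) + ζ * (d / h - σ⁻¹)) := by
    rw [hd_def]
    ring
  have hspeed : |(ζ' - ζ) * (d / h)| ≤ 2 * (h / δ) * (h / δ / h) := by
    rw [abs_of_nonneg (by positivity)]
    gcongr
    linarith
  have hslope : |ζ * (d / h - σ⁻¹)| ≤ 2 * ((2 * s + 2 * s ^ 2) / δ ^ 3 * h) := by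
    rw [abs_mul, abs_of_nonneg hζ]
    gcongr
  rw [hsplit, abs_mul, abs_of_nonneg (sub_nonneg.2 hm'.2)]
  have : 0 ≤ 4 * s / δ ^ 2 * h := by positivity
  calc (1 - m) * |(ζ' - ζ) * (d / h) + ζ * (d / h - σ⁻¹)|
      ≤ |(ζ' - ζ) * (d / h) + ζ * (d / h - σ⁻¹)| :=
        mul_le_of_le_one_left (abs_nonneg _) (by linarith [hm'.1])
    _ ≤ 2 * (h / δ) * (h / δ / h) + 2 * ((2 * s + 2 * s ^ 2) / δ ^ 3 * h) :=
        (abs_add_le _ _).trans (add_le_add hspeed hslope)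
    _ = consistencyConst s δ * h - 4 * s / δ ^ 2 * h := by
        unfold consistencyConst
        field_simp
        ring
    _ ≤ consistencyConst s δ * h := by linarith

lemma abs_neg_one_add_two_div_sq_le {x : ℝ} (hs : 0 ≤ s) (hx : 0 ≤ x) :
    |-1 + 2 / (1 + x * s) ^ 2| ≤ 1 := by
  have : 2 / (1 + x * s) ^ 2 ≤ 2 :=
    div_le_self zero_le_two (one_le_pow₀ (le_add_of_nonneg_right (mul_nonneg hx hs)))
  have : 0 ≤ 2 / (1 + x * s) ^ 2 := by positivity
  exact abs_le.2 ⟨by linarith, by linarith⟩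

lemma hasDerivWithinAt_charCost_charFoot (hs : 0 ≤ s) (hm : m ∈ Ioc (0 : ℝ) 1) :
    HasDerivWithinAt (fun r => charCost r (charFoot r m))
      ((-1 + 2 / (1 + charFoot s m * s) ^ 2)
        * ((1 - m) * valRight s m * (charSlope s (charFoot s m))⁻¹) - valRight s m ^ 2 / 2)
      (Ici 0) s := by
  have hfoot := hasDerivWithinAt_charFoot_time hs hm
  refine (hfoot.neg.add (hasDerivWithinAt_charVal_curve hs (charFoot_mem hm).1.le
    hfoot)).congr_deriv ?_
  unfold valRight
  ring

lemma abs_minority_defect_le (hs : 0 ≤ s) (hδ : 0 < δ) (hm : δ ≤ m) (hh : 0 < h)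
    (hmh : m + h ≤ 1) :
    |(-1 + 2 / (1 + charFoot s m * s) ^ 2)
        * ((1 - m) * valRight s m * (charSlope s (charFoot s m))⁻¹)
      - (1 - m) / h * valRight s m
        * (charCost s (charFoot s (m + h)) - charCost s (charFoot s m))|
      ≤ consistencyConst s δ * h := by
  have hm' : m ∈ Ioc (0 : ℝ) 1 := ⟨hδ.trans_le hm, by linarith⟩
  have hmh' : m + h ∈ Ioc (0 : ℝ) 1 := ⟨by linarith [hm'.1], hmh⟩
  obtain ⟨hd, hdle⟩ := charFoot_add_sub_mem hs hδ hm hh.le hmh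
  have hfoot := (charFoot_mem (t := s) hm').1.le
  have htaylor := abs_charFoot_diffQuot_sub_le hs hδ hm hh hmh
  have hcost := abs_charCost_sub_sub_le hs hfoot (charFoot_mem (t := s) hmh').1.le
  have hζ := valRight_nonneg hs hm'
  have hζ2 := valRight_le_two hs hm'
  have hκ := abs_neg_one_add_two_div_sq_le hs hfoot
  set κ := -1 + 2 / (1 + charFoot s m * s) ^ 2
  set σ := charSlope s (charFoot s m)
  set ζ := valRight s m
  set w := charCost s (charFoot s (m + h)) - charCost s (charFoot s m)
  set d := charFoot s (m + h) - charFoot s m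
  have hsplit : κ * ((1 - m) * ζ * σ⁻¹) - (1 - m) / h * ζ * w
      = (1 - m) * ζ * (-(κ * (d / h - σ⁻¹)) - (w - κ * d) / h) := by
    ring
  have hslope : |-(κ * (d / h - σ⁻¹))| ≤ 1 * ((2 * s + 2 * s ^ 2) / δ ^ 3 * h) := by
    rw [abs_neg, abs_mul]
    gcongr
  have hrem : |(w - κ * d) / h| ≤ 2 * s * (h / δ) ^ 2 / h := by
    rw [abs_div, abs_of_pos hh]
    refine div_le_div_of_nonneg_right (hcost.trans ?_) hh.le
    gcongr
  have hcoef : |(1 - m) * ζ| ≤ 1 * 2 := by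
    rw [abs_mul, abs_of_nonneg hζ, abs_of_nonneg (sub_nonneg.2 hm'.2)]
    gcongr
    linarith [hm'.1]
  rw [hsplit, abs_mul]
  have : 0 ≤ 2 / δ ^ 2 * h := by positivity
  calc |(1 - m) * ζ| * |-(κ * (d / h - σ⁻¹)) - (w - κ * d) / h|
      ≤ 1 * 2 * (1 * ((2 * s + 2 * s ^ 2) / δ ^ 3 * h) + 2 * s * (h / δ) ^ 2 / h) := by
        gcongr
        exact (abs_sub _ _).trans (add_le_add hslope hrem)
    _ = consistencyConst s δ * h - 2 / δ ^ 2 * h := by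
        unfold consistencyConst
        field_simp
        ring
    _ ≤ consistencyConst s δ * h := by linarith

end Consistency

/-- The mean state of `N` players of which `k` are in state `1`. -/
def gridMean (N k : ℕ) : ℝ := 2 * ((k : ℝ) / N) - 1

section GridMean

variable {N k : ℕ}

lemma gridMean_succ (N k : ℕ) : gridMean N (k + 1) = gridMean N k + 2 / N := by
  unfold gridMean
  push_cast
  ring

lemma gridMean_self (hN : 0 < N) : gridMean N N = 1 := by
  have : (N : ℝ) ≠ 0 := Nat.cast_ne_zero.2 hN.ne'
  unfold gridMean
  rw [div_self this]
  norm_num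

lemma gridMean_le_one (hkN : k ≤ N) : gridMean N k ≤ 1 := by
  have : (k : ℝ) / N ≤ 1 := div_le_one_of_le₀ (Nat.cast_le.2 hkN) N.cast_nonneg
  unfold gridMean
  linarith

lemma natCast_sub_eq_gridMean (hN : 0 < N) (hkN : k ≤ N) :
    ((N - k : ℕ) : ℝ) = (1 - gridMean N k) / (2 / N) := by
  have : (N : ℝ) ≠ 0 := Nat.cast_ne_zero.2 hN.ne'
  rw [Nat.cast_sub hkN, gridMean]
  field_simp
  ring

lemma gridMean_sub (hN : 0 < N) (hkN : k ≤ N) : gridMean N (N - k) = -gridMean N k := by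
  have : (N : ℝ) ≠ 0 := Nat.cast_ne_zero.2 hN.ne'
  unfold gridMean
  rw [Nat.cast_sub hkN]
  field_simp
  ring

lemma gridMean_mem_Ioc (hkN : k ≤ N) (hk : N < 2 * k) : gridMean N k ∈ Ioc (0 : ℝ) 1 := by
  have hN : (0 : ℝ) < N := Nat.cast_pos.2 (by omega)
  refine ⟨?_, gridMean_le_one hkN⟩
  have hk' : (N : ℝ) < 2 * k := by exact_mod_cast hk
  rw [gridMean, ← mul_div_assoc, sub_pos, lt_div_iff₀ hN]
  linarith

lemma two_mul_le_gridMean {ε : ℝ} (hN : 0 < N) (hk : (1 / 2 + ε) * N ≤ k) :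
    2 * ε ≤ gridMean N k := by
  have := (le_div_iff₀ (Nat.cast_pos.2 hN)).2 hk
  unfold gridMean
  linarith

end GridMean

/-- The limit value, at time `s` before the end, of a player whose state is shared by `k` of the
`N` other players, `k > N / 2`. -/
def majorityApprox (N k : ℕ) (s : ℝ) : ℝ := -charFoot s (gridMean N k)

/-- The limit value, at time `s` before the end, of a player whose state is opposite to that of
`k` of the `N` other players, `k > N / 2`. -/
def minorityApprox (N k : ℕ) (s : ℝ) : ℝ := charCost s (charFoot s (gridMean N k))

section Approx

variable {T ε s : ℝ} {N k k₀ : ℕ}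

lemma minorityApprox_sub_majorityApprox (N k : ℕ) (s : ℝ) :
    minorityApprox N k s - majorityApprox N k s = valRight s (gridMean N k) := by
  unfold minorityApprox majorityApprox charCost valRight
  ring

lemma abs_majorityApprox_le_one (hm : gridMean N k ∈ Ioc (0 : ℝ) 1) :
    |majorityApprox N k s| ≤ 1 := by
  have hfoot := charFoot_mem (t := s) hm
  rw [majorityApprox, abs_neg, abs_of_pos hfoot.1]
  exact hfoot.2

lemma abs_minorityApprox_le_one (hs : 0 ≤ s) (hm : gridMean N k ∈ Ioc (0 : ℝ) 1) :
    |minorityApprox N k s| ≤ 1 :=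
  abs_charCost_le hs (Ioc_subset_Icc_self (charFoot_mem hm))

lemma abs_majorityApprox_succ_sub_le {δ : ℝ} (hs : 0 ≤ s) (hδ : 0 < δ) (hm : δ ≤ gridMean N k)
    (hkN : k < N) : |majorityApprox N (k + 1) s - majorityApprox N k s| ≤ 2 / N / δ := by
  have hd := charFoot_add_sub_mem hs hδ hm (by positivity)
    (gridMean_succ N k ▸ gridMean_le_one hkN)
  rw [majorityApprox, majorityApprox, neg_sub_neg, abs_sub_comm, gridMean_succ, abs_of_nonneg hd.1]
  exact hd.2

lemma abs_minorityApprox_succ_sub_le {δ : ℝ} (hs : 0 ≤ s) (hδ : 0 < δ) (hm : δ ≤ gridMean N k)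
    (hkN : k < N) : |minorityApprox N (k + 1) s - minorityApprox N k s| ≤ 2 / N / δ := by
  have hd := charFoot_add_sub_mem hs hδ hm (by positivity)
    (gridMean_succ N k ▸ gridMean_le_one hkN)
  rw [minorityApprox, minorityApprox, gridMean_succ]
  exact (abs_charCost_sub_le hs (charFoot_mem ⟨hδ.trans_le hm, gridMean_le_one hkN.le⟩).1.le
    (sub_nonneg.1 hd.1)).trans hd.2

lemma exists_deriv_majorityApprox {δ : ℝ} (hs : 0 ≤ s) (hδ : 0 < δ) (hm : δ ≤ gridMean N k)
    (hN : 0 < N) (hkN : k ≤ N) :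
    ∃ p', HasDerivWithinAt (majorityApprox N k) p' (Ici 0) s ∧
      |p' - majorityField N (fun j => majorityApprox N j s) (fun j => minorityApprox N j s) k|
        ≤ consistencyConst s δ * (2 / N) := by
  refine ⟨_, (hasDerivWithinAt_charFoot_time hs ⟨hδ.trans_le hm, gridMean_le_one hkN⟩).neg, ?_⟩
  have := consistencyConst_nonneg hs hδ
  simp only [majorityField, minorityApprox_sub_majorityApprox]
  rcases hkN.eq_or_lt with rfl | hkN
  · rw [gridMean_self hN, Nat.sub_self]
    norm_num
    positivity
  · rw [majorityApprox, majorityApprox, natCast_sub_eq_gridMean hN hkN.le, gridMean_succ]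
    exact abs_majority_defect_le hs hδ hm (by positivity)
      (gridMean_succ N k ▸ gridMean_le_one hkN)

lemma exists_deriv_minorityApprox {δ : ℝ} (hs : 0 ≤ s) (hδ : 0 < δ) (hm : δ ≤ gridMean N k)
    (hN : 0 < N) (hkN : k ≤ N) :
    ∃ q', HasDerivWithinAt (minorityApprox N k) q' (Ici 0) s ∧
      |q' - minorityField N (fun j => majorityApprox N j s) (fun j => minorityApprox N j s) k|
        ≤ consistencyConst s δ * (2 / N) := by
  refine ⟨_, hasDerivWithinAt_charCost_charFoot hs ⟨hδ.trans_le hm, gridMean_le_one hkN⟩, ?_⟩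
  have := consistencyConst_nonneg hs hδ
  simp only [minorityField, minorityApprox_sub_majorityApprox]
  rw [sub_eq_add_neg (_ * _), add_comm, add_sub_add_left_eq_sub]
  rcases hkN.eq_or_lt with rfl | hkN
  · rw [gridMean_self hN, Nat.sub_self]
    norm_num
    positivity
  · rw [minorityApprox, minorityApprox, natCast_sub_eq_gridMean hN hkN.le, gridMean_succ]
    exact abs_minority_defect_le hs hδ hm (by positivity)
      (gridMean_succ N k ▸ gridMean_le_one hkN)

lemma isReducedApprox_approx (T : ℝ) (hε : 0 < ε) (hN : 0 < N) (hk₀ : (1 / 2 + ε) * N ≤ k₀) :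
    IsReducedApprox T N k₀ (1 / ε) (consistencyConst T (2 * ε) * (2 / N)) (majorityApprox N)
      (minorityApprox N) := by
  have hδ : 0 < 2 * ε := by positivity
  have hN' : (0 : ℝ) < N := Nat.cast_pos.2 hN
  have hmean {k : ℕ} (hk : k₀ ≤ k) : 2 * ε ≤ gridMean N k :=
    two_mul_le_gridMean hN (hk₀.trans (Nat.cast_le.2 hk))
  have hmem {k : ℕ} (hk : k ∈ Finset.Icc k₀ N) : gridMean N k ∈ Ioc (0 : ℝ) 1 :=
    ⟨hδ.trans_le (hmean (Finset.mem_Icc.1 hk).1), gridMean_le_one (Finset.mem_Icc.1 hk).2⟩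
  have hincrement {d : ℝ} (h : d ≤ 2 / N / (2 * ε)) : N * d ≤ 1 / ε :=
    (mul_le_mul_of_nonneg_left h hN'.le).trans_eq (by field_simp)
  have hmono {s : ℝ} (hs : s ∈ Icc 0 T) :
      consistencyConst s (2 * ε) * (2 / N) ≤ consistencyConst T (2 * ε) * (2 / N) :=
    mul_le_mul_of_nonneg_right (consistencyConst_mono hs.1 hs.2 hδ) (by positivity)
  constructor <;> intro k hk
  case initial_majority =>
    rw [majorityApprox, charFoot_zero_left (hmem hk), gridMean]
    ring
  case initial_minority =>
    rw [minorityApprox, charFoot_zero_left (hmem hk), charCost, charVal, gridMean]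
    ring
  all_goals intro s hs
  case abs_sub_le_two =>
    rw [minorityApprox_sub_majorityApprox, abs_of_nonneg (valRight_nonneg hs.1 (hmem hk))]
    exact valRight_le_two hs.1 (hmem hk)
  case increment_majority =>
    obtain ⟨hk, hkN⟩ := Finset.mem_Ico.1 hk
    exact hincrement (abs_majorityApprox_succ_sub_le hs.1 hδ (hmean hk) hkN)
  case increment_minority =>
    obtain ⟨hk, hkN⟩ := Finset.mem_Ico.1 hk
    exact hincrement (abs_minorityApprox_succ_sub_le hs.1 hδ (hmean hk) hkN)
  case deriv_majority =>
    obtain ⟨hk, hkN⟩ := Finset.mem_Icc.1 hk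
    obtain ⟨p', hp', hle⟩ := exists_deriv_majorityApprox hs.1 hδ (hmean hk) hN hkN
    exact ⟨p', hp'.mono Icc_subset_Ici_self, hle.trans (hmono hs)⟩
  case deriv_minority =>
    obtain ⟨hk, hkN⟩ := Finset.mem_Icc.1 hk
    obtain ⟨q', hq', hle⟩ := exists_deriv_minorityApprox hs.1 hδ (hmean hk) hN hkN
    exact ⟨q', hq'.mono Icc_subset_Ici_self, hle.trans (hmono hs)⟩

/-- The constant in the estimate of the values. The first summand makes the estimate trivial for
`ε * N < 1`, where the comparison principle does not apply. -/
def valueConst (T ε : ℝ) : ℝ :=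
  2 / ε + 2 * consistencyConst T (2 * ε) * Real.exp ((2 * (1 / ε) + 5) * T)

lemma two_div_le_valueConst (hT : 0 ≤ T) (hε : 0 < ε) : 2 / ε ≤ valueConst T ε := by
  have := consistencyConst_nonneg hT (by positivity : 0 < 2 * ε)
  exact le_add_of_nonneg_right (by positivity)

lemma tendsto_valueConst (hT : 0 ≤ T) : Tendsto (valueConst T) (𝓝[>] 0) atTop := by
  have hinv : Tendsto (fun ε : ℝ => 2 / ε) (𝓝[>] 0) atTop := by
    simpa only [div_eq_mul_inv] using tendsto_inv_nhdsGT_zero.const_mul_atTop two_pos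
  refine tendsto_atTop_mono' _ ?_ hinv
  filter_upwards [self_mem_nhdsWithin] with ε hε
  exact two_div_le_valueConst hT hε

variable {v : ℕ → ℝ → ℝ}

lemma IsGridValue.abs_sub_approx_le_two (hv : IsGridValue T N v) (hkN : k ≤ N)
    (hk : N < 2 * k) (hs : s ∈ Icc 0 T) :
    |v k s - majorityApprox N k s| ≤ 2 ∧ |v (N - k) s - minorityApprox N k s| ≤ 2 :=
  ⟨abs_sub_le_two (hv.abs_le_one k hkN s hs)
      (abs_majorityApprox_le_one (gridMean_mem_Ioc hkN hk)),
    abs_sub_le_two (hv.abs_le_one (N - k) (N.sub_le k) s hs)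
      (abs_minorityApprox_le_one hs.1 (gridMean_mem_Ioc hkN hk))⟩

lemma IsGridValue.abs_sub_approx_le_of_one_le (hv : IsGridValue T N v) (hT : 0 ≤ T)
    (hε : 0 < ε) (hεN : 1 ≤ ε * N) (hkN : k ≤ N) (hk : (1 / 2 + ε) * N ≤ k) (hs : s ∈ Icc 0 T) :
    |v k s - majorityApprox N k s| ≤ valueConst T ε / N ∧
      |v (N - k) s - minorityApprox N k s| ≤ valueConst T ε / N := by
  have hN : 0 < N := by
    rcases N.eq_zero_or_pos with rfl | hN
    · norm_num at hεN
    · exact hN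
  have hN' : (0 : ℝ) < N := Nat.cast_pos.2 hN
  have hk₀ := Nat.le_ceil ((1 / 2 + ε) * N)
  set k₀ := ⌈(1 / 2 + ε) * N⌉₊
  have hk₀N : N + 2 ≤ 2 * k₀ := by
    have : (N : ℝ) + 2 ≤ 2 * k₀ := by linarith
    exact_mod_cast this
  have hC := consistencyConst_nonneg hT (by positivity : 0 < 2 * ε)
  have hconst : consistencyConst T (2 * ε) * (2 / N) * Real.exp ((2 * (1 / ε) + 5) * T)
      ≤ valueConst T ε / N := by
    rw [le_div_iff₀ hN', valueConst]
    have : 0 ≤ 2 / ε := by positivity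
    field_simp
    linarith
  have hcompare := hv.abs_sub_le (isReducedApprox_approx T hε hN hk₀) (by omega) (by omega)
    (by positivity) (by positivity) (Finset.mem_Icc.2 ⟨Nat.ceil_le.2 hk, hkN⟩) hs
  exact ⟨hcompare.1.trans hconst, hcompare.2.trans hconst⟩

lemma lt_two_mul_of_mul_natCast_le (hε : 0 < ε) (hN : 0 < N) (hk : (1 / 2 + ε) * N ≤ k) :
    N < 2 * k := by
  have : 0 < ε * N := mul_pos hε (Nat.cast_pos.2 hN)
  have : (N : ℝ) < 2 * k := by linarith
  exact_mod_cast this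

lemma IsGridValue.abs_sub_approx_le (hv : IsGridValue T N v) (hT : 0 ≤ T) (hε : 0 < ε)
    (hN : 0 < N) (hkN : k ≤ N) (hk : (1 / 2 + ε) * N ≤ k) (hs : s ∈ Icc 0 T) :
    |v k s - majorityApprox N k s| ≤ valueConst T ε / N ∧
      |v (N - k) s - minorityApprox N k s| ≤ valueConst T ε / N := by
  rcases lt_or_ge (ε * N) 1 with hεN | hεN
  · have htrivial : 2 ≤ valueConst T ε / N := by
      rw [le_div_iff₀ (Nat.cast_pos.2 hN)]
      refine le_trans ?_ (two_div_le_valueConst hT hε)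
      rw [le_div_iff₀ hε]
      linarith
    have hbound := hv.abs_sub_approx_le_two hkN (lt_two_mul_of_mul_natCast_le hε hN hk) hs
    exact ⟨hbound.1.trans htrivial, hbound.2.trans htrivial⟩
  · exact hv.abs_sub_approx_le_of_one_le hT hε hεN hkN hk hs

variable {Z : ℝ → ℝ → ℝ} {U : ℝ → ℤˣ → ℝ → ℝ} {V : ℕ → ℝ → ℝ → ℝ}

lemma IsMasterSolution.eq_approx (hT : 0 < T)
    (hZ : IsEntropySolution flux (fun m => 2 * m) T (fun _ => 0) Z) (hU : IsMasterSolution T Z U)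
    (hkN : k ≤ N) (hk : N < 2 * k) (hs : s ∈ Icc 0 T) :
    U (T - s) 1 (gridMean N k) = majorityApprox N k s ∧
      U (T - s) 1 (gridMean N (N - k)) = minorityApprox N k s := by
  rw [gridMean_sub (by omega) hkN]
  exact ⟨hU.eq_neg_charFoot_of_entropy hT hZ hs (gridMean_mem_Ioc hkN hk),
    hU.neg_eq_charCost_of_entropy hT hZ hs (gridMean_mem_Ioc hkN hk)⟩

theorem valueEstimate_valueConst (hT : 0 < T)
    (hZ : IsEntropySolution flux (fun m => 2 * m) T (fun _ => 0) Z) (hU : IsMasterSolution T Z U)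
    (hV : ∀ N : ℕ, 1 ≤ N → IsNashValue T N (V N)) : ValueEstimate T U V (valueConst T) := by
  rintro ε hε N hN t ht _ ⟨⟨k, hkN, rfl⟩, hkε⟩
  obtain ⟨s, hs, rfl⟩ : ∃ s ∈ Icc 0 T, t = T - s := ⟨T - t, sub_mem_Icc_zero ht, by ring⟩
  have hv := (hV N hN).isGridValue hN
  have hN' : (0 : ℝ) < N := Nat.cast_pos.2 hN
  rw [← gridMean]
  rw [mem_Ioo, not_and_or, not_lt, not_lt, div_le_iff₀ hN', le_div_iff₀ hN'] at hkε
  rcases hkε with hle | hge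
  · have hsub : (1 / 2 + ε) * N ≤ ((N - k : ℕ) : ℝ) := by
      rw [Nat.cast_sub hkN]
      linarith
    have hbound := (hv.abs_sub_approx_le hT.le hε hN (N.sub_le k) hsub hs).2
    have heq := (hU.eq_approx hT hZ (N.sub_le k)
      (lt_two_mul_of_mul_natCast_le hε hN hsub) hs).2
    rw [Nat.sub_sub_self hkN] at hbound heq
    rwa [heq]
  · rw [(hU.eq_approx hT hZ hkN (lt_two_mul_of_mul_natCast_le hε hN hge) hs).1]
    exact (hv.abs_sub_approx_le hT.le hε hN hkN hge hs).1

end Approx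

/-! ### Blow-up of the constants -/

lemma sub_le_mul_sub_of_exists_deriv_le {f : ℝ → ℝ} {a b C : ℝ} (hab : a ≤ b)
    (hf : ∀ s ∈ Icc a b, ∃ d ≤ C, HasDerivWithinAt f d (Icc a b) s) :
    f b - f a ≤ C * (b - a) := by
  choose! d hdC hd using hf
  have hderiv {s : ℝ} (hs : s ∈ interior (Icc a b)) : HasDerivAt f (d s) s :=
    (hd s (interior_subset hs)).hasDerivAt (mem_interior_iff_mem_nhds.1 hs)
  refine Convex.image_sub_le_mul_sub_of_deriv_le (convex_Icc a b)
    (fun s hs => (hd s hs).continuousWithinAt)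
    (fun s hs => (hderiv hs).differentiableAt.differentiableWithinAt) (fun s hs => ?_)
    a (left_mem_Icc.2 hab) b (right_mem_Icc.2 hab) hab
  rw [(hderiv hs).deriv]
  exact hdC s (interior_subset hs)

section BlowUp

variable {T M κ s m : ℝ} {N k : ℕ}

/-- After the time `1 / 2` of the formation of the shock, the characteristics that have not met it
start away from the origin. -/
lemma sub_half_le_mul_charFoot (hm : m ∈ Ioc (0 : ℝ) 1) :
    s - 1 / 2 ≤ s * charFoot s m := by
  have hfoot := charFoot_mem (t := s) hm
  have hpos := charPos_charFoot_pos (t := s) hm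
  set x := charFoot s m
  have hfactor : charPos s x = x * (1 - 2 * s + 2 * (s * x) - s ^ 2 * (x * (1 - x))) := by
    unfold charPos; ring
  have := pos_of_mul_pos_right (hfactor ▸ hpos) hfoot.1.le
  have : 0 ≤ s ^ 2 * (x * (1 - x)) :=
    mul_nonneg (sq_nonneg s) (mul_nonneg hfoot.1.le (sub_nonneg.2 hfoot.2))
  linarith

lemma two_mul_div_le_valRight (hκ : 0 < κ) (hs : s ∈ Icc (1 / 2 + κ) T)
    (hm : m ∈ Ioc (0 : ℝ) 1) : 2 * (κ / (T * (1 + T))) ≤ valRight s m := by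
  obtain ⟨hs, hsT⟩ := hs
  have hfoot := charFoot_mem (t := s) hm
  have hs0 : 0 < s := by linarith
  have hT : 0 < T := hs0.trans_le hsT
  have hκle : κ / T ≤ charFoot s m := by
    rw [div_le_iff₀' hT]
    linarith [sub_half_le_mul_charFoot (s := s) hm,
      mul_le_mul_of_nonneg_right hsT hfoot.1.le]
  have hsle : charFoot s m * s ≤ T :=
    (mul_le_of_le_one_left hs0.le hfoot.2).trans hsT
  have hfoot0 : 0 < charFoot s m := hfoot.1
  have : 0 < charFoot s m * s := mul_pos hfoot0 hs0
  calc 2 * (κ / (T * (1 + T))) = 2 * (κ / T) / (1 + T) := by field_simp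
    _ ≤ 2 * charFoot s m / (1 + charFoot s m * s) := by gcongr

lemma minorityApprox_succ_sub_le (hκ : 0 < κ) (hs : 1 / 2 + κ ≤ s) (hkN : k < N)
    (hk : N < 2 * k) : minorityApprox N (k + 1) s - minorityApprox N k s ≤ 2 / κ / N := by
  have hs0 : 0 ≤ s := by linarith
  have hm := gridMean_mem_Ioc hkN.le hk
  have hn := gridMean_mem_Ioc (k := k + 1) hkN (by omega)
  have hmn : gridMean N k ≤ gridMean N (k + 1) := by
    rw [gridMean_succ]
    exact le_add_of_nonneg_right (by positivity)
  have hcost := abs_charCost_sub_le hs0 (charFoot_mem hm).1.le (charFoot_mono hs0 hm hn hmn)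
  refine ((le_abs_self _).trans hcost).trans ((charFoot_sub_le hs0 hκ hm hn hmn ?_).trans_eq ?_)
  · linarith [sub_half_le_mul_charFoot (s := s) hm, hm.1]
  · rw [gridMean_succ, add_sub_cancel_left, div_right_comm]

variable {v : ℕ → ℝ → ℝ}

/-- The term `k * (v (N - k) - v k) ^ 2`, of order `N`, has no counterpart in the limit: a player in
the minority who is about to join a tie would leave it at once. -/
lemma IsGridValue.exists_deriv_center_le {c B : ℝ} (hv : IsGridValue T N v) (hk : N + 1 = 2 * k)
    (hs : s ∈ Icc 0 T) (hc : 0 ≤ c) (hB : 0 ≤ B) (hgap : c ≤ v (N - k) s - v k s)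
    (hstep : v (N - (k + 1)) s - v (N - k) s ≤ B / N) :
    ∃ d ≤ 2 * B - c ^ 2 / 2 * N, HasDerivWithinAt (v (N - k)) d (Icc 0 T) s := by
  refine ⟨_, ?_, hv.hasDerivWithinAt_center hk hs⟩
  have hN : (0 : ℝ) < N := Nat.cast_pos.2 (by omega)
  have hNk : (N : ℝ) ≤ 2 * k := by exact_mod_cast (by omega : N ≤ 2 * k)
  have hgap2 : v (N - k) s - v k s ≤ 2 := (le_abs_self _).trans
    (abs_sub_le_two (hv.abs_le_one (N - k) (N.sub_le k) s hs) (hv.abs_le_one k (by omega) s hs))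
  simp only [minorityField]
  set z := v (N - k) s - v k s
  have hz : 0 ≤ z := hc.trans hgap
  have htransport : ((N - k : ℕ) : ℝ) * z * (v (N - (k + 1)) s - v (N - k) s) ≤ 2 * B := by
    calc ((N - k : ℕ) : ℝ) * z * (v (N - (k + 1)) s - v (N - k) s)
        ≤ ((N - k : ℕ) : ℝ) * z * (B / N) := by gcongr
      _ ≤ N * 2 * (B / N) := by
        have := natCast_sub_le N k
        gcongr
      _ = 2 * B := by field_simp
  have hdamping : c ^ 2 / 2 * N ≤ k * z ^ 2 := by
    calc c ^ 2 / 2 * N ≤ c ^ 2 / 2 * (2 * k) := by gcongr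
      _ = k * c ^ 2 := by ring
      _ ≤ k * z ^ 2 := by gcongr
  linarith [sq_nonneg z]

lemma IsGridValue.mul_le_two_of_approx_le (hv : IsGridValue T N v) (hκ : 0 < κ)
    (hκT : 1 / 2 + κ ≤ T) (hk : N + 1 = 2 * k) (hk2 : 2 ≤ k) (hM : 0 ≤ M)
    (hMN : 2 * M / N ≤ κ / (T * (1 + T)))
    (happrox : ∀ j ≤ N, N < 2 * j → ∀ s ∈ Icc 0 T, |v j s - majorityApprox N j s| ≤ M / N ∧
      |v (N - j) s - minorityApprox N j s| ≤ M / N) :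
    ((κ / (T * (1 + T))) ^ 2 / 2 * N - 2 * (2 * M + 2 / κ)) * (T - (1 / 2 + κ)) ≤ 2 := by
  set c := κ / (T * (1 + T))
  have hT : 0 < T := by linarith
  have hsub : Icc (1 / 2 + κ) T ⊆ Icc 0 T := Icc_subset_Icc (by linarith) le_rfl
  have hderiv (s : ℝ) (hs : s ∈ Icc (1 / 2 + κ) T) :
      ∃ d ≤ 2 * (2 * M + 2 / κ) - c ^ 2 / 2 * N,
        HasDerivWithinAt (v (N - k)) d (Icc (1 / 2 + κ) T) s := by
    obtain ⟨hmajority, hminority⟩ := happrox k (by omega) (by omega) s (hsub hs)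
    have hnext := (happrox (k + 1) (by omega) (by omega) s (hsub hs)).2
    rw [abs_le] at hmajority hminority hnext
    have hM2 : 2 * M / N = M / N + M / N := by ring
    have hgap : c ≤ v (N - k) s - v k s := by
      linarith [two_mul_div_le_valRight hκ hs (gridMean_mem_Ioc (N := N) (k := k) (by omega)
        (by omega)), minorityApprox_sub_majorityApprox N k s]
    have hstep : v (N - (k + 1)) s - v (N - k) s ≤ (2 * M + 2 / κ) / N := by
      rw [add_div]
      linarith [minorityApprox_succ_sub_le hκ hs.1 (by omega : k < N) (by omega)]
    obtain ⟨d, hd, hvd⟩ := hv.exists_deriv_center_le hk (hsub hs) (by positivity)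
      (by positivity) hgap hstep
    exact ⟨d, hd, hvd.mono hsub⟩
  have hdecay := sub_le_mul_sub_of_exists_deriv_le hκT hderiv
  have hbound := abs_sub_le_two
    (hv.abs_le_one (N - k) (N.sub_le k) _ (hsub (left_mem_Icc.2 hκT)))
    (hv.abs_le_one (N - k) (N.sub_le k) _ (hsub (right_mem_Icc.2 hκT)))
  linarith [(abs_le.1 hbound).2]

lemma not_forall_approx_le {v : ℕ → ℕ → ℝ → ℝ} (hT : 1 / 2 < T)
    (hv : ∀ N, 1 ≤ N → IsGridValue T N (v N)) :
    ¬ ∀ N, 1 ≤ N → ∀ j ≤ N, N < 2 * j → ∀ s ∈ Icc 0 T,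
      |v N j s - majorityApprox N j s| ≤ M / N ∧
        |v N (N - j) s - minorityApprox N j s| ≤ M / N := by
  intro happrox
  have hM : 0 ≤ M := by
    simpa using (abs_nonneg _).trans
      (happrox 1 le_rfl 1 le_rfl (by norm_num) 0 ⟨le_rfl, by linarith⟩).1
  obtain ⟨κ, hκ, hκT⟩ : ∃ κ > 0, 1 / 2 + κ < T := ⟨(T - 1 / 2) / 2, by linarith, by linarith⟩
  set c := κ / (T * (1 + T)) with hc_def
  have : 0 < T := by linarith
  have hc : 0 < c := by positivity
  set L := T - (1 / 2 + κ) with hL_def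
  have hL : 0 < L := sub_pos.2 hκT
  obtain ⟨k, hk⟩ := exists_nat_gt
    (max 2 (max (2 * M / c) ((2 / L + 2 * (2 * M + 2 / κ)) / (c ^ 2 / 2))))
  obtain ⟨hk2, hkM, hkL⟩ : (2 : ℝ) < k ∧ 2 * M / c < k ∧
      (2 / L + 2 * (2 * M + 2 / κ)) / (c ^ 2 / 2) < k := by
    simpa only [max_lt_iff] using hk
  have hk2 : 2 < k := by exact_mod_cast hk2
  have hkN : (k : ℝ) ≤ (2 * k - 1 : ℕ) := by exact_mod_cast (by omega : k ≤ 2 * k - 1)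
  have hN : (0 : ℝ) < (2 * k - 1 : ℕ) := Nat.cast_pos.2 (by omega)
  have hMN : 2 * M / (2 * k - 1 : ℕ) ≤ c := by
    rw [div_le_iff₀ hN, ← div_le_iff₀' hc]
    exact hkM.le.trans hkN
  have hle := (hv _ (by omega)).mul_le_two_of_approx_le hκ hκT.le (by omega) hk2.le hM hMN
    (happrox _ (by omega))
  rw [← hc_def, ← hL_def, ← le_div_iff₀ hL] at hle
  rw [div_lt_iff₀' (by positivity)] at hkL
  linarith [mul_le_mul_of_nonneg_left hkN (by positivity : 0 ≤ c ^ 2 / 2)]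

variable {Z : ℝ → ℝ → ℝ} {U : ℝ → ℤˣ → ℝ → ℝ} {V : ℕ → ℝ → ℝ → ℝ} {C : ℝ → ℝ}

lemma ValueEstimate.abs_sub_le_of_frequently (hC : ValueEstimate T U V C)
    (hM : ∃ᶠ ε in 𝓝[>] 0, C ε < M) (hN : 1 ≤ N) {t : ℝ} (ht : t ∈ Icc 0 T) (hkN : k ≤ N)
    (hk : 2 * k ≠ N) : |V N t (k / N) - U t 1 (gridMean N k)| ≤ M / N := by
  have hN' : (0 : ℝ) < N := Nat.cast_pos.2 hN
  have hhalf : (k : ℝ) / N ≠ 1 / 2 := by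
    rw [Ne, div_eq_div_iff hN'.ne' two_ne_zero, one_mul, mul_comm]
    exact_mod_cast hk
  obtain ⟨ε, hCε, hε, hεk⟩ := (hM.and_eventually
    (Ioo_mem_nhdsGT (abs_pos.2 (sub_ne_zero.2 hhalf)))).exists
  refine (hC ε hε N hN t ht _ ⟨⟨k, hkN, rfl⟩, fun hmem => ?_⟩).trans
    (div_le_div_of_nonneg_right hCε.le hN'.le)
  exact hεk.not_gt (abs_lt.2 ⟨by linarith [hmem.1], by linarith [hmem.2]⟩)

theorem tendsto_atTop_of_valueEstimate (hT : 1 / 2 < T)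
    (hZ : IsEntropySolution flux (fun m => 2 * m) T (fun _ => 0) Z) (hU : IsMasterSolution T Z U)
    (hV : ∀ N : ℕ, 1 ≤ N → IsNashValue T N (V N)) (hC : ValueEstimate T U V C) :
    Tendsto C (𝓝[>] 0) atTop := by
  by_contra hnot
  obtain ⟨M, hM⟩ : ∃ M, ∃ᶠ ε in 𝓝[>] 0, C ε < M := by
    simpa only [tendsto_atTop, not_forall, not_eventually, not_le] using hnot
  refine not_forall_approx_le (M := M) hT (fun N hN => (hV N hN).isGridValue hN)
    fun N hN j hjN hj s hs => ?_
  obtain ⟨hmajority, hminority⟩ := hU.eq_approx (by linarith) hZ hjN hj hs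
  rw [← hmajority, ← hminority]
  exact ⟨hC.abs_sub_le_of_frequently hM hN (sub_mem_Icc_zero hs) hjN (by omega),
    hC.abs_sub_le_of_frequently hM hN (sub_mem_Icc_zero hs) (N.sub_le j) (by omega)⟩

end BlowUp

end

end TwoStateMFG

theorem theorem3p5 (T : ℝ) (hT : 0 < T) :
    -- the limit objects exist
    (∃ (Z : ℝ → ℝ → ℝ) (U : ℝ → ℤˣ → ℝ → ℝ),
      TwoStateMFG.IsEntropySolution TwoStateMFG.flux (fun m => 2 * m) T (fun _ => 0) Z ∧
      TwoStateMFG.IsMasterSolution T Z U) ∧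
    -- the value functions of the games exist
    (∀ N : ℕ, 1 ≤ N → ∃ V : ℝ → ℝ → ℝ, TwoStateMFG.IsNashValue T N V) ∧
    -- convergence, with a constant that depends on `T` and `ε` only
    (∃ C : ℝ → ℝ, Tendsto C (𝓝[>] 0) atTop ∧
      ∀ (Z : ℝ → ℝ → ℝ) (U : ℝ → ℤˣ → ℝ → ℝ) (V : ℕ → ℝ → ℝ → ℝ),
        TwoStateMFG.IsEntropySolution TwoStateMFG.flux (fun m => 2 * m) T (fun _ => 0) Z →
        TwoStateMFG.IsMasterSolution T Z U →
        (∀ N : ℕ, 1 ≤ N → TwoStateMFG.IsNashValue T N (V N)) →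
        TwoStateMFG.ValueEstimate T U V C) ∧
    -- when the limit is discontinuous, every admissible constant blows up
    (1 / 2 < T →
      ∀ (Z : ℝ → ℝ → ℝ) (U : ℝ → ℤˣ → ℝ → ℝ) (V : ℕ → ℝ → ℝ → ℝ),
        TwoStateMFG.IsEntropySolution TwoStateMFG.flux (fun m => 2 * m) T (fun _ => 0) Z →
        TwoStateMFG.IsMasterSolution T Z U →
        (∀ N : ℕ, 1 ≤ N → TwoStateMFG.IsNashValue T N (V N)) →
        ∀ C : ℝ → ℝ, TwoStateMFG.ValueEstimate T U V C → Tendsto C (𝓝[>] 0) atTop) := by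
  refine ⟨⟨_, _, TwoStateMFG.isEntropySolution_entropySol hT,
      TwoStateMFG.isMasterSolution_masterSol hT⟩,
    fun N hN => TwoStateMFG.exists_isNashValue hT hN,
    ⟨TwoStateMFG.valueConst T, TwoStateMFG.tendsto_valueConst hT.le, fun Z U V hZ hU hV =>
      TwoStateMFG.valueEstimate_valueConst hT hZ hU hV⟩,
    fun hT2 Z U V hZ hU hV C hC =>
      TwoStateMFG.tendsto_atTop_of_valueEstimate hT2 hZ hU hV hC⟩
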